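/- For a binary word $x$, let $A^-(x)$ be the least number of states of a deterministic finite automaton $M$, whose transition function need not be total, such that $x$ is the only word of length $|x|$ accepted by $M$. Let $A_N(x)$ be the least number of states of a nondeterministic finite automaton (without $\varepsilon$-transitions) that accepts $x$ and has only one accepting path of length $|x|$, where a path is a sequence of labelled edges. An infinite binary sequence $x_0x_1x_2\dots$ is produced by a $k$-stage linear feedback shift register ($k\ge 1$) if there is a linear map $F:\mathbb F_2^k\to\mathbb F_2$ with $x_{t+k}=F(x_t,\dots,x_{t+k-1})$ for all $t\ge 0$; if the sequence of register contents $(x_t,\dots,x_{t+k-1})$, $t\ge 0$, has eventual period $P=2^k-1$, then the word $x_0x_1\dots x_{P-1}$ is called an $m$-sequence. Theorem. There exists a binary word $x$ with $A^-(x)-A_N(x)\ge 2$. In fact, there is an $m$-sequence $x$ with $A^-(x)-A_N(x)=2$: the word $x=0001010110100001100100111110111$ is an $m$-sequence with $A^-(x)=18$ and $A_N(x)=16$. -/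

import Mathlib

/-! ### Automatic complexity -/

/-- A deterministic finite automaton whose transition function need not be total:
`step s a = none` means that there is no transition out of `s` labelled `a`. -/
structure PartialDFA (α σ : Type) where
  step : σ → α → Option σ
  start : σ
  accept : Set σ

namespace PartialDFA

/-- The state reached from the start state after reading `w`, if the run does not get stuck. -/
def eval {α σ : Type} (M : PartialDFA α σ) (w : List α) : Option σ :=
  w.foldlM M.step M.start

/-- The language recognized by a partial deterministic automaton. -/
def accepts {α σ : Type} (M : PartialDFA α σ) : Set (List α) :=
  {w | ∃ s ∈ M.accept, M.eval w = some s}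

end PartialDFA

/-- The non-total deterministic automatic complexity `A⁻(x)`: the least number of states of a
partial deterministic automaton `M` such that `x` is the only word of length `|x|` in `L(M)`. -/
noncomputable def detComplexity {α : Type} (x : List α) : ℕ :=
  sInf {q | ∃ M : PartialDFA α (Fin q), M.accepts ∩ {w | w.length = x.length} = {x}}

/-- The accepting paths of length `n` of a nondeterministic automaton `M`: a path from a start
state to an accepting state, together with the word of length `n` that labels its edges. -/
def NFA.AcceptingPath {α σ : Type} (M : NFA α σ) (n : ℕ) : Type :=
  Σ (s : M.start) (t : M.accept) (w : {w : List α // w.length = n}), M.Path s t w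

/-- The nondeterministic automatic complexity `A_N(x)`: the least number of states of a
nondeterministic automaton accepting `x` that has only one accepting path of length `|x|`. -/
noncomputable def nondetComplexity {α : Type} (x : List α) : ℕ :=
  sInf {q | ∃ M : NFA α (Fin q), x ∈ M.accepts ∧ Subsingleton (M.AcceptingPath x.length)}

/-! ### Shift registers -/

/-- The `k`-stage shift register with feedback function `F`:
`(x₀, …, x_{k-1}) ↦ (x₁, …, x_{k-1}, F (x₀, …, x_{k-1}))`. -/
def shiftRegister {α : Type} {k : ℕ} (F : (Fin k → α) → α) (v : Fin k → α) : Fin k → α :=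
  fun i => if h : i.val + 1 < k then v ⟨i.val + 1, h⟩ else F v

/-- The eventual period of an infinite sequence: the least `N > 0` such that `s (n + N) = s n`
for all large `n` (and `0` if the sequence is not eventually periodic). -/
noncomputable def eventualPeriod {β : Type} (s : ℕ → β) : ℕ :=
  sInf {N | 0 < N ∧ ∃ M, ∀ n, M ≤ n → s (n + N) = s n}

/-- `w` is a binary `m`-sequence: for some `k`-stage linear feedback shift register over `𝔽₂`
with infinite output `x`, the sequence of register contents has eventual period `2 ^ k - 1`,
and `w` consists of the first `2 ^ k - 1` terms of `x`. -/
def IsMSequence (w : List (ZMod 2)) : Prop :=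
  ∃ (k : ℕ) (F : (Fin k → ZMod 2) →ₗ[ZMod 2] ZMod 2) (x : ℕ → ZMod 2),
    0 < k ∧
    (∀ t, (shiftRegister F)^[t] (fun i : Fin k => x i) = fun i : Fin k => x (t + i)) ∧
    eventualPeriod (fun t => (shiftRegister F)^[t] (fun i : Fin k => x i)) = 2 ^ k - 1 ∧
    w = List.ofFn (fun i : Fin (2 ^ k - 1) => x i)

/-- The binary sequence `0001010110100001100100111110111` of length `31`. -/
def mSeq : List (ZMod 2) :=
  [0, 0, 0, 1, 0, 1, 0, 1, 1, 0, 1, 0, 0, 0, 0, 1, 1, 0, 0, 1, 0, 0, 1, 1, 1, 1, 1, 0, 1, 1, 1]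

/-!
An automaton that accepts a word `x` of length `31` in only one way gives a walk `s 0, …, s 31` on
its states that is *rigid* (`IsRigid`): no other walk of length `31` along its labelled edges leads
from `s 0` to `s 31`. Conversely the edges of a rigid walk form such an automaton
(`NFA.ofWalk`, `PartialDFA.ofWalk`). So the two complexities are the least numbers of states of a
rigid walk with the labels `x`, in the deterministic case of one whose next state depends only on
the state and the label. The upper bounds are two explicit walks, the first one going up to a loop
and back. Their rigidity is checked by computing which states can still reach the end in time.

For the lower bounds, let the *gap* of a time be the distance to the previous visit of the same
state, or `0` at a first visit. The number of states is the number of first visits, so rigid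
walks with many revisits have to be excluded. Rigidity restricts the gap function a lot.

* A walk from `s 0` along the edges that is somewhere off `s` never comes back to `s` in time
  (`IsRigid.not_deviates`).
* Crossing pairs of consecutive visits have the same gap (`IsRigid.gap_eq_of_cross`), and the times
  of a given gap form an interval (`IsRigid.gap_between`), a *run*, on which the word has that gap
  as a period. The states visited during a run are not visited after it (`IsRun.prev_lt`).
* Leaving out loops of a run makes the walk deviate. So the time lost cannot be made up later
  by other loops: gaps that divide, or are multiples of, an earlier gap do not occur
  (`IsRun.excluded`), and neither do those that are a sum of an earlier removable length and a length
  removable from the loop itself (`admissible_of_gap`).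
* A revisit uses up a first visit, except for third and later visits; these belong to squares in the
  word, which are few (`two_mul_card_revisits_le`, `card_innerVisits_le`).

A search over all gap functions, run by run, that cuts off by these rules finds none with `17`
revisits, and none with `15` when the walk is deterministic (`search_nondeterministic`,
`search_deterministic`); gap functions that survive to the end are refuted by a second word that
leads to `s 31`. The search is evaluated by the kernel, and `SearchState.search_eq_true` says that it
would succeed on the gap function of a rigid walk with enough revisits. With `32` times, this leaves
at least `16`, and `18`, first visits.
-/

/-! ### Walks that are determined by their length -/

section Walk

variable {σ α : Type} (s : ℕ → σ) (x : ℕ → α) (n : ℕ)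

/-- `w` labels a walk from `u` to `v` that uses only the labelled edges
`s j —x j→ s (j + 1)`, `j < n`, of the walk `s`. -/
def Trace : List α → σ → σ → Prop
  | [], u, v => u = v
  | c :: w, u, v => ∃ j < n, u = s j ∧ c = x j ∧ Trace w (s (j + 1)) v

/-- The walk `s 0, …, s n` with labels `x` is the only walk of length `n` from `s 0` to `s n`
along its own edges. -/
structure IsRigid : Prop where
  state_eq : ∀ w₁ w₂ v, Trace s x n w₁ (s 0) v → Trace s x n w₂ v (s n) →
    w₁.length + w₂.length = n → v = s w₁.length
  word_eq : ∀ w, Trace s x n w (s 0) (s n) → w.length = n → w = (List.range n).map x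

/-- The label determines the edge taken from a state of the walk. -/
def IsDeterministic : Prop :=
  ∀ i < n, ∀ j < n, s i = s j → x i = x j → s (i + 1) = s (j + 1)

/-- There is a walk of length `k` from `u` to `v` along the edges of the walk `s`. -/
def Reach (k : ℕ) (u v : σ) : Prop := ∃ w, w.length = k ∧ Trace s x n w u v

/-- There is a walk of length `k` from `s 0` to `v` along the edges of the walk `s` that is not a
prefix of `s`. -/
def Deviates (k : ℕ) (v : σ) : Prop :=
  ∃ i m u, i + m = k ∧ Reach s x n i (s 0) u ∧ u ≠ s i ∧ Reach s x n m u v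

/-- The distance from `t` to the previous visit of the state `s t`; it is `0` if there is none. -/
noncomputable def gap (t : ℕ) : ℕ := sInf {d | 0 < d ∧ d ≤ t ∧ s (t - d) = s t}

variable {s x n}

theorem Trace.append {w₁ w₂ : List α} {u v z : σ} (h₁ : Trace s x n w₁ u v)
    (h₂ : Trace s x n w₂ v z) : Trace s x n (w₁ ++ w₂) u z := by
  induction w₁ generalizing u with
  | nil => cases h₁; exact h₂
  | cons c w ih =>
    obtain ⟨j, hj, hu, hc, h⟩ := h₁
    exact ⟨j, hj, hu, hc, ih h⟩

theorem Trace.edge {j : ℕ} (hj : j < n) : Trace s x n [x j] (s j) (s (j + 1)) :=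
  ⟨j, hj, rfl, rfl, rfl⟩

theorem trace_segment (i k : ℕ) (h : i + k ≤ n) :
    Trace s x n ((List.range k).map fun r => x (i + r)) (s i) (s (i + k)) := by
  induction k with
  | zero => rfl
  | succ k ih =>
    rw [List.range_succ, List.map_append]
    exact (ih (by omega)).append (Trace.edge (by omega))

theorem Reach.trans {k m : ℕ} {u v z : σ} (h₁ : Reach s x n k u v) (h₂ : Reach s x n m v z) :
    Reach s x n (k + m) u z := by
  obtain ⟨w₁, rfl, h₁⟩ := h₁
  obtain ⟨w₂, rfl, h₂⟩ := h₂
  exact ⟨w₁ ++ w₂, by simp, h₁.append h₂⟩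

theorem reach_self (u : σ) : Reach s x n 0 u u := ⟨[], rfl, rfl⟩

theorem reach_segment {i j : ℕ} (h : i ≤ j) (hj : j ≤ n) :
    Reach s x n (j - i) (s i) (s j) := by
  have := trace_segment (s := s) (x := x) (n := n) i (j - i) (by omega)
  rw [Nat.add_sub_cancel' h] at this
  exact ⟨_, by simp, this⟩

theorem Reach.iterate {k : ℕ} {u : σ} (h : Reach s x n k u u) (m : ℕ) :
    Reach s x n (m * k) u u := by
  induction m with
  | zero => simpa using reach_self u
  | succ m ih => simpa [Nat.succ_mul] using ih.trans h

theorem Deviates.trans {k m : ℕ} {u v : σ} (h₁ : Deviates s x n k u) (h₂ : Reach s x n m u v) :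
    Deviates s x n (k + m) v := by
  obtain ⟨i, m', z, rfl, h, hz, h'⟩ := h₁
  exact ⟨i, m' + m, z, by omega, h, hz, h'.trans h₂⟩

theorem IsRigid.not_deviates (H : IsRigid s x n) {i : ℕ} (hi : i ≤ n) :
    ¬ Deviates s x n i (s i) := by
  rintro ⟨j, m, u, rfl, ⟨w₁, rfl, h₁⟩, hu, h₂⟩
  obtain ⟨w₂, hl, h₂⟩ := h₂.trans (reach_segment hi le_rfl)
  exact hu (H.state_eq w₁ w₂ u h₁ h₂ (by omega))

/-- Parallel edges of a rigid walk have the same label. -/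
theorem IsRigid.label_eq (H : IsRigid s x n) {i j : ℕ} (hi : i < n) (hj : j < n)
    (h : s i = s j) (h' : s (i + 1) = s (j + 1)) : x i = x j := by
  have h₁ := trace_segment (s := s) (x := x) (n := n) 0 i (by omega)
  have h₂ := Trace.edge (s := s) (x := x) hj
  have h₃ := trace_segment (s := s) (x := x) (n := n) (i + 1) (n - (i + 1)) (by omega)
  rw [← h, ← h'] at h₂
  rw [Nat.add_sub_cancel' hi] at h₃
  simp only [zero_add] at h₁
  have h₄ := H.word_eq _ ((h₁.append h₂).append h₃) (by simp; omega)
  have h₅ := congrArg (fun l => l[i]?) h₄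
  simpa [hi] using h₅.symm

theorem gap_spec {t : ℕ} (h : 0 < gap s t) : gap s t ≤ t ∧ s (t - gap s t) = s t := by
  have hne : {d | 0 < d ∧ d ≤ t ∧ s (t - d) = s t}.Nonempty := by
    by_contra hne
    rw [Set.not_nonempty_iff_eq_empty] at hne
    simp [gap, hne] at h
  exact (Nat.sInf_mem hne).2

theorem gap_le {t d : ℕ} (h₀ : 0 < d) (h : d ≤ t) (hs : s (t - d) = s t) :
    0 < gap s t ∧ gap s t ≤ d := by
  have hd : d ∈ {d | 0 < d ∧ d ≤ t ∧ s (t - d) = s t} := ⟨h₀, h, hs⟩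
  exact ⟨(Nat.sInf_mem ⟨d, hd⟩).1, Nat.sInf_le hd⟩

/-- Two crossing pairs of consecutive visits, `u … v … u … v`, have the same distance: otherwise
the first and the last of the three segments could be exchanged. -/
theorem IsRigid.gap_eq_of_cross (H : IsRigid s x n) {a b : ℕ} (ha : 0 < gap s a)
    (hb : 0 < gap s b) (h₁ : a - gap s a < b - gap s b) (h₂ : b - gap s b ≤ a) (h₃ : a < b)
    (hn : b ≤ n) : gap s a = gap s b := by
  obtain ⟨ha', hsa⟩ := gap_spec ha
  obtain ⟨hb', hsb⟩ := gap_spec hb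
  generalize hi : a - gap s a = i at *
  generalize hk : b - gap s b = k at *
  by_contra hne
  -- The segments are `i … k` (A), `k … a` (B) and `a … b` (C), with `s i = s a` and `s k = s b`;
  -- the walk also has room for them in the order C, B, A.
  have hAC : k - i ≠ b - a := by omega
  have r₁ := reach_segment (s := s) (x := x) (n := n) (Nat.zero_le i) (by omega)
  have rA := reach_segment (s := s) (x := x) (n := n) h₁.le (by omega)
  have rB := reach_segment (s := s) (x := x) (n := n) h₂ (by omega)
  have rC := reach_segment (s := s) (x := x) (n := n) h₃.le (by omega)
  rw [← hsa, ← hsb] at rC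
  rw [← hsa] at rB
  have e₁ : s (i + (b - a)) = s b := by
    by_contra hc
    refine H.not_deviates hn ⟨i + (b - a), (a - k) + (k - i), s k, by omega, ?_, ?_, ?_⟩
    · simpa using r₁.trans rC
    · rw [hsb]; exact fun h => hc h.symm
    · rw [← hsb]; exact rB.trans rA
  have e₂ : s (i + (b - a) + (a - k)) = s a := by
    by_contra hc
    refine H.not_deviates hn ⟨i + (b - a) + (a - k), k - i, s i, by omega, ?_, ?_, ?_⟩
    · simpa using (r₁.trans rC).trans rB
    · rw [hsa]; exact fun h => hc h.symm
    · rw [← hsb]; exact rA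
  rcases lt_or_gt_of_ne hAC with h | h
  · have := gap_le (s := s) (t := b) (d := b - (i + (b - a))) (by omega) (by omega)
      (by rw [← e₁]; congr 1; omega)
    omega
  · have := gap_le (s := s) (t := a) (d := a - (i + (b - a) + (a - k))) (by omega) (by omega)
      (by rw [← e₂]; congr 1; omega)
    omega

/-- If the step after a time of gap `d` keeps repeating the walk `d` steps earlier, its gap is `d`: a
smaller gap would cross the one before. -/
theorem IsRigid.gap_succ (H : IsRigid s x n) {e d : ℕ} (hd : 0 < d) (he : gap s e = d)
    (hs : s (e + 1 - d) = s (e + 1)) (hn : e + 1 ≤ n) : gap s (e + 1) = d := by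
  obtain ⟨he', -⟩ := gap_spec (s := s) (t := e) (by omega)
  obtain ⟨h₁, h₂⟩ := gap_le (s := s) hd (by omega) hs
  by_contra hne
  have := H.gap_eq_of_cross (a := e) (b := e + 1) (by omega) h₁ (by omega) (by omega) (by omega) hn
  omega

/-- Times of equal gap form an interval: otherwise a loop could be moved from the one place to
the other. -/
theorem IsRigid.gap_between (H : IsRigid s x n) {a b c d : ℕ} (hd : 0 < d) (ha : gap s a = d)
    (hb : gap s b = d) (hac : a ≤ c) (hcb : c ≤ b) (hn : b ≤ n) : gap s c = d := by
  obtain ⟨ha', hsa⟩ := gap_spec (s := s) (t := a) (by omega)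
  obtain ⟨hb', hsb⟩ := gap_spec (s := s) (t := b) (by omega)
  rw [ha] at hsa ha'
  rw [hb] at hsb hb'
  -- The loop at `a` can be left out, and the one at `b` be walked twice instead.
  have per : ∀ i, a - d ≤ i → i < b - d → s i = s (i + d) := by
    intro i h₁ h₂
    by_contra hc
    refine H.not_deviates (i := b - d) (by omega)
      ⟨i, b - d - i, s (i + d), by omega, ?_, fun h => hc h.symm, ?_⟩
    · have r₁ := reach_segment (s := s) (x := x) (n := n) (Nat.zero_le (a - d)) (by omega)
      have r₂ := reach_segment (s := s) (x := x) (n := n) (i := a) (j := i + d) (by omega)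
        (by omega)
      rw [hsa] at r₁
      have := r₁.trans r₂
      rwa [show a - d - 0 + (i + d - a) = i by omega] at this
    · rw [hsb]
      have r := reach_segment (s := s) (x := x) (n := n) (i := i + d) (j := b) (by omega)
        (by omega)
      rwa [show b - (i + d) = b - d - i by omega] at r
  induction c, hac using Nat.le_induction with
  | base => exact ha
  | succ c hac ih =>
    refine H.gap_succ hd (ih (by omega)) ?_ (by omega)
    rcases Nat.lt_or_ge (c + 1 - d) (b - d) with h | h
    · rw [per _ (by omega) h]; congr 1; omega
    · obtain rfl : c + 1 = b := by omega
      exact hsb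

theorem IsRigid.label_eq_of_gap (H : IsRigid s x n) {c d : ℕ} (hd : 0 < d) (h : gap s c = d)
    (h' : gap s (c + 1) = d) (hn : c < n) : x c = x (c - d) := by
  obtain ⟨h₁, h₂⟩ := gap_spec (s := s) (t := c) (by omega)
  obtain ⟨h₃, h₄⟩ := gap_spec (s := s) (t := c + 1) (by omega)
  rw [h] at h₁ h₂
  rw [h'] at h₄
  refine H.label_eq hn (by omega) h₂.symm ?_
  rw [← h₄]; congr 1; omega

/-- If a visit is neither the first nor the last one, its gap equals that of the next visit. -/
theorem IsRigid.gap_prev (H : IsRigid s x n) {t : ℕ} (h : 0 < gap s t)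
    (h' : 0 < gap s (t - gap s t)) (hn : t ≤ n) : gap s (t - gap s t) = gap s t := by
  obtain ⟨h₁, h₂⟩ := gap_spec h
  obtain ⟨h₃, h₄⟩ := gap_spec h'
  exact H.gap_eq_of_cross h' h (by omega) le_rfl (by omega) hn

/-- Distinct times have distinct previous visits. -/
theorem prev_injective {t t' : ℕ} (h : 0 < gap s t) (h' : 0 < gap s t')
    (he : t - gap s t = t' - gap s t') : t = t' := by
  wlog hlt : t < t' generalizing t t'
  · by_contra hne
    exact hne (this h' h he.symm (by omega)).symm
  exfalso
  obtain ⟨h₁, h₂⟩ := gap_spec h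
  obtain ⟨h₃, h₄⟩ := gap_spec h'
  have := gap_le (s := s) (t := t') (d := t' - t) (by omega) (by omega)
    (by rw [Nat.sub_sub_self hlt.le, ← h₂, he, h₄])
  omega

/-! ### Runs -/

/-- The times `t, …, t + l - 1` have gap `d`, and the time `t + l` does not; nothing is
said about the time before `t`. -/
structure IsRun (s : ℕ → σ) (n t d l : ℕ) : Prop where
  pos : 0 < d
  len : 0 < l
  gap_eq : ∀ i < l, gap s (t + i) = d
  le : t + l ≤ n + 1
  maximal : t + l ≤ n → gap s (t + l) ≠ d

namespace IsRun

variable {t d l : ℕ} (R : IsRun s n t d l)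
include R

theorem d_le : d ≤ t := by
  have := R.gap_eq 0 R.len
  have hp := R.pos
  simp only [add_zero] at this
  have := (gap_spec (s := s) (t := t) (by omega)).1
  omega

theorem eq_sub {i : ℕ} (hi : i < l) : s (t + i - d) = s (t + i) := by
  have h := R.gap_eq i hi
  have hp := R.pos
  have := (gap_spec (s := s) (t := t + i) (by omega)).2
  rwa [h] at this

theorem eq_add {j : ℕ} (h₁ : t - d ≤ j) (h₂ : j + d < t + l) : s (j + d) = s j := by
  have := R.d_le
  have h := R.eq_sub (i := j + d - t) (by omega)
  rw [show t + (j + d - t) = j + d by omega, Nat.add_sub_cancel] at h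
  exact h.symm

theorem eq_add_mul {j : ℕ} (k : ℕ) (h₁ : t - d ≤ j) (h₂ : j + k * d < t + l) :
    s (j + k * d) = s j := by
  induction k with
  | zero => simp
  | succ k ih =>
    rw [Nat.succ_mul] at h₂ ⊢
    rw [← Nat.add_assoc, R.eq_add (by omega) (by omega), ih (by omega)]

end IsRun

end Walk

/-! ### The search over gap functions -/

/-!
The functions of this part are evaluated by the kernel, on natural number literals. They are
therefore written with recursors and with the operations on `ℕ` that the kernel computes natively,
and `force` keeps their arguments literals; `force`, `bite`, `band`, `bor` and `bneg` are
continuation passing, `if`, `&&`, `||` and `!`, evaluated lazily from the left. Sets of times and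
of distances are bit masks.
-/

/-- Continuation with a natural number argument; the kernel evaluates `n` before passing it on. -/
noncomputable def force {β : Type} (n : ℕ) (k : ℕ → β) : β :=
  Nat.rec (k 0) (fun m _ => k (Nat.succ m)) n

/-- `if b then u else v`, by the recursor. -/
noncomputable def bite {β : Type} (b : Bool) (u v : β) : β := Bool.rec v u b
noncomputable def band (b c : Bool) : Bool := Bool.rec false c b
noncomputable def bor (b c : Bool) : Bool := Bool.rec c true b
noncomputable def bneg (b : Bool) : Bool := Bool.rec true false b
/-- The `i`-th bit of `M`, as membership of `i` in the set `M`. -/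
def bitAt (M i : ℕ) : Bool := Nat.beq (Nat.land (Nat.shiftRight M i) 1) 1
def ltb (a b : ℕ) : Bool := Nat.ble (Nat.succ a) b

/-- The times that may still be revisited, the last one first. With a time `p` go the set `F` of the
gaps that are impossible for a revisit of `p` or of an earlier time, the set `Y` of the lengths by
which the walk from `p` to the current time can be shortened, and the set `Z` of the lengths by
which the walk up to `p` can be shortened so that it deviates. Here a length `z` is stored in `Z` as
the bit `32 - z`, which turns the comparison of a sum of lengths with a gap into a shift. -/
inductive Stack
  | nil
  | cons (p F Y Z : ℕ) (rest : Stack)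

/-- The runs that have been chosen: start `t`, gap `d` and length `l` of each, the last one first. -/
inductive Runs
  | nil
  | cons (t d l : ℕ) (rest : Runs)

/-- The word `mSeq`, its letter at `i` being the bit `i`. -/
def wordBits : ℕ := 0x77c985a8

/-- A bound, for `1 ≤ d ≤ 3`, on the number of inner visits (see `innerVisits`) of gap `d` from time
`t` on. It comes from the factors of the word that have period `d`, and are as long as `2 * d` at
least. -/
noncomputable def excessBound (t d : ℕ) : ℕ :=
  bite (Nat.beq d 1) (bite (Nat.ble t 24) 4 (bite (Nat.ble t 30) 2 0)) <|
  bite (Nat.beq d 2) (bite (Nat.ble t 4) 3 (bite (Nat.ble t 25) 2 0)) (bite (Nat.ble t 20) 2 0)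

/-- `excessBound`, or `0` if the set `G` of excluded gaps contains `d`. -/
noncomputable def excessOf (G t d : ℕ) : ℕ := bite (bitAt G d) 0 (excessBound t d)

/-- A bound on the number of inner visits from time `t` on when the gaps in `G` are excluded. Gaps
above `3` contribute none, as the word has no square of such a period. -/
noncomputable def excess (G t : ℕ) : ℕ :=
  bite (Nat.beq (Nat.land G 14) 14) 0
    (Nat.add (Nat.add (excessOf G t 1) (excessOf G t 2)) (excessOf G t 3))

/-- For `0 < d, q < 32`, the bit `32 * d + q` tells whether `q` divides `d` or is a multiple of `d`. -/
def commensurableTable : ℕ := 0x800000024000846e20000002100040960800020a04002006020000220100115e00800002004008060020008a00100436000800020004024e00020002000101164000802a10004086040020020100105e00400802401004260804020a01010116102040824104104e42108422111111164924924a55555556fffffffe00000000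

/-- The set of the positive `q < 32` that divide `d` or are multiples of `d`. -/
def commensurable (d : ℕ) : ℕ :=
  Nat.mod (Nat.shiftRight commensurableTable (Nat.mul 32 d)) 0x100000000

/-- The union of the sets `M + k * d`, `1 ≤ k ≤ m`. -/
noncomputable def upShifts (M d m : ℕ) : ℕ :=
  Nat.rec 0 (fun k ih => Nat.lor ih (Nat.shiftLeft M (Nat.mul (Nat.succ k) d))) m

/-- The union of the sets `M - k * d`, `1 ≤ k ≤ m`. -/
noncomputable def downShifts (M d m : ℕ) : ℕ :=
  Nat.rec 0 (fun k ih => Nat.lor ih (Nat.shiftRight M (Nat.mul (Nat.succ k) d))) m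

/-- Adds to the set `M` of times those that each run `(t, d, l)` in turn identifies with one of them:
it identifies `i` with `i + d` for `t - d ≤ i < t - d + l`. -/
noncomputable def spread (rs : Runs) : ℕ → ℕ :=
  Runs.rec (fun M => M) (fun t d l _ ih => fun M =>
    force (Nat.shiftLeft (Nat.sub (Nat.pow 2 l) 1) (Nat.sub t d)) fun A =>
    force (Nat.lor (Nat.lor M (Nat.shiftLeft (Nat.land M A) d)) (Nat.land (Nat.shiftRight M d) A))
      ih) rs

/-- Follows the edges of the walk, its states identified as the runs tell, for `k` more steps; `W` is
the rest of the word. `S` is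
a set of times at whose states the letters read so far can lead; `D` is such a set for other words
of the same length. The value tells whether `D` reaches the time `31`. -/
noncomputable def deviates (rs : Runs) (k : ℕ) : ℕ → ℕ → ℕ → Bool :=
  Nat.rec (fun _ _ D => bitAt D 31) (fun _ ih => fun W S D =>
    force (bite (bitAt W 0) wordBits (Nat.sub 0x7fffffff wordBits)) fun E =>
    force (spread rs (spread rs (Nat.shiftLeft (Nat.land S E) 1))) fun S' =>
    force (spread rs (spread rs (Nat.shiftLeft (Nat.lor (Nat.land D 0x7fffffff)
      (Nat.land S (Nat.sub 0x7fffffff E))) 1))) fun D' =>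
    force (Nat.shiftRight W 1) fun W' => ih W' S' D') k

/-- A second word is found that leads from the start to the end of the walk in `31` steps. -/
noncomputable def refuted (rs : Runs) : Bool :=
  deviates rs 31 wordBits (spread rs (spread rs 1)) 0

/-- Adds the lengths `M` to the set `Y` of the top element. -/
noncomputable def addTop (M : ℕ) (L : Stack) : Stack :=
  Stack.rec .nil (fun p F Y Z rest _ => force (Nat.lor Y M) fun Y' => .cons p F Y' Z rest) L

/-- Too few revisits can still follow. `K` is twice the number of revisits that is asked for; `c` is
twice the number of those before `t`, plus `32 - t`. There are at most `32 - t` others, and twice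
their number is at most `32 - t + h + P` if `h` times can still be revisited and `P` bounds the
number of inner visits. -/
noncomputable def prune (K c t h P : ℕ) : Bool :=
  bor (ltb (Nat.add c (Nat.add h P)) K) (ltb (Nat.add c (Nat.sub 32 t)) K)

/-- Tries all lengths `l`, and ends `t' = t + l`, of a run that starts at `t` and at first goes back to
`p`. The bits of `y` compare the labels of the steps into `t'` and into its counterpart: they have
to agree for the run to go on at `t'`, and to differ for it to end at `t'` when the walk is
deterministic, unless the walk itself ends there. `f` is fuel, and `B` the set of the times that may
be revisited. The argument `k` continues the search. -/
noncomputable def tryRun (k : ℕ → ℕ → Bool) (det : Bool) (t p B f : ℕ) : ℕ → ℕ → ℕ → Bool :=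
  Nat.rec (fun _ _ _ => false) (fun _ ih => fun l t' y =>
    bor (band (bor (bneg det) (bor (bitAt y 0) (Nat.beq t' 32))) (k l t'))
      (band (bneg (bitAt y 0)) (band (Nat.ble t' 31)
        (band (bor (Nat.ble t (Nat.add p l)) (bitAt B (Nat.add p l)))
          (force (Nat.succ l) fun l' => force (Nat.succ t') fun t'' =>
            force (Nat.shiftRight y 1) fun y' => ih l' t'' y'))))) f

/-- The gap `d` is not in `F`, and it is not the sum of a length by which the walk to the current time
can be shortened, deviating, and of a length by which the loop of length `d` can be shortened. -/
noncomputable def admissible (d F Y Z : ℕ) : Bool :=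
  band (bneg (bitAt F d)) (Nat.beq (Nat.land Y (Nat.shiftRight Z (Nat.sub 32 d))) 0)

/-- Tries all times in `L` as the previous visit of the state at time `t`, where `a` collects the
sets `Y` that have been passed and `h` bounds the number of the times below; these have to be at
least `b`. -/
noncomputable def tryGaps (k : ℕ → ℕ → ℕ → Stack → ℕ → ℕ → ℕ → ℕ → Bool) (det : Bool)
    (t b Z B : ℕ) (L : Stack) : ℕ → ℕ → Bool :=
  Stack.rec (fun _ _ => false) (fun p F Y Zp rest ih => fun a h =>
    bite (ltb h b) false
      (force (Nat.lor a Y) fun a' =>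
        bor (force (Nat.sub t p) fun d => band (admissible d F a' Z)
          (force (Nat.xor (Nat.shiftRight wordBits t) (Nat.shiftRight wordBits p)) fun y =>
            force (Nat.succ t) fun t' => tryRun (k d p Zp rest h a') det t p B 31 1 t' y))
        (force (Nat.sub h 1) fun h' => ih a' h'))) L

/-- Records a run of gap `d`, length `l` and start `t`, and goes on at its end `t'`. The times from
`p = t - d` on cannot be revisited any more. -/
noncomputable def close
    (next : ℕ → ℕ → ℕ → Stack → ℕ → ℕ → ℕ → Runs → Bool) (K P t c B G Z : ℕ) (rs : Runs)
    (d p Zp : ℕ) (rest : Stack) (h a l t' : ℕ) : Bool :=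
  force (Nat.add c l) fun c' => bite (prune K c' t' h P) false
    (force (Nat.div (Nat.sub (Nat.add d l) 1) d) fun m =>
      force (Nat.lor G (commensurable d)) fun G' =>
      force (Nat.lor Z (downShifts (Nat.lor Zp 0x100000000) d m)) fun Z' =>
      force (Nat.mod B (Nat.pow 2 p)) fun B' =>
        next t' c' h (addTop (Nat.lor a (upShifts 1 d m)) rest) B' G' Z' (.cons t d l rs))

/-- Searches for the gap function of a rigid walk from time `t` on. `L`, whose length `h` bounds, and
`B` hold the times that may be revisited; `G` is the set of the excluded gaps, `Z` that of the
lengths by which the walk up to now can be shortened so that it deviates, stored as in `Stack`; `rs`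
lists the runs so far, `K` and `c` are as in `prune`, and `f` is fuel. A run is at most `5` long,
hence the summand in the bound for `tryGaps`. -/
noncomputable def search (det : Bool) (K f : ℕ) :
    ℕ → ℕ → ℕ → Stack → ℕ → ℕ → ℕ → Runs → Bool :=
  Nat.rec (fun _ _ _ _ _ _ _ _ => false) (fun _ ih => fun t c h L B G Z rs =>
    force (excess G t) fun P =>
    bite (prune K c t h P) false (bite (Nat.beq t 32) (bneg (refuted rs))
      (bor (force (Nat.sub K (Nat.add (Nat.add c P) 5)) fun b =>
          tryGaps (close ih K P t c B G Z rs) det t b Z B L 0 (Nat.sub h 1))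
        (force (Nat.succ t) fun t' => force (Nat.lor B (Nat.shiftLeft 1 t)) fun B' =>
          ih t' (Nat.sub c 1) (Nat.succ h) (.cons t G 0 Z L) B' G Z rs)))) f

theorem search_nondeterministic : search false 34 33 0 32 0 .nil 0 0 0 .nil = false := by
  decide +kernel

theorem search_deterministic : search true 30 33 0 32 0 .nil 0 0 0 .nil = false := by
  decide +kernel

/-! ### Bits -/

theorem force_eq {β : Type} (n : ℕ) (k : ℕ → β) : force n k = k n := by cases n <;> rfl

theorem bite_eq {β : Type} (b : Bool) (u v : β) : bite b u v = if b then u else v := by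
  cases b <;> rfl

theorem band_eq (b c : Bool) : band b c = (b && c) := by cases b <;> rfl

theorem bor_eq (b c : Bool) : bor b c = (b || c) := by cases b <;> rfl

theorem bneg_eq (b : Bool) : bneg b = !b := by cases b <;> rfl

theorem ltb_eq (a b : ℕ) : ltb a b = decide (a < b) := by
  rw [Bool.eq_iff_iff, decide_eq_true_iff]
  exact iff_of_eq Nat.ble_eq

theorem ble_eq_decide (a b : ℕ) : Nat.ble a b = decide (a ≤ b) := by
  rw [Bool.eq_iff_iff, decide_eq_true_iff]
  exact iff_of_eq Nat.ble_eq

theorem natBeq_eq_decide (a b : ℕ) : Nat.beq a b = decide (a = b) := by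
  rw [Bool.eq_iff_iff, decide_eq_true_iff]
  exact iff_of_eq Nat.beq_eq

theorem bitAt_eq (M i : ℕ) : bitAt M i = M.testBit i := by
  have : bitAt M i = decide ((M >>> i) &&& 1 = 1) := natBeq_eq_decide _ _
  rw [this, Nat.and_one_is_mod, Nat.testBit_eq_decide_div_mod_eq, Nat.shiftRight_eq_div_pow]

theorem bitAt_lor (a b i : ℕ) : bitAt (Nat.lor a b) i = (bitAt a i || bitAt b i) := by
  simp only [bitAt_eq]; exact Nat.testBit_or a b i

theorem bitAt_land (a b i : ℕ) : bitAt (Nat.land a b) i = (bitAt a i && bitAt b i) := by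
  simp only [bitAt_eq]; exact Nat.testBit_and a b i

theorem bitAt_xor (a b i : ℕ) : bitAt (Nat.xor a b) i = (bitAt a i ^^ bitAt b i) := by
  simp only [bitAt_eq]; exact Nat.testBit_xor a b i

theorem bitAt_shiftLeft (a k i : ℕ) :
    bitAt (Nat.shiftLeft a k) i = (decide (k ≤ i) && bitAt a (i - k)) := by
  simp only [bitAt_eq]; exact Nat.testBit_shiftLeft a

theorem bitAt_shiftRight (a k i : ℕ) : bitAt (Nat.shiftRight a k) i = bitAt a (k + i) := by
  simp only [bitAt_eq]; exact Nat.testBit_shiftRight a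

theorem bitAt_mod (a k i : ℕ) :
    bitAt (Nat.mod a (Nat.pow 2 k)) i = (decide (i < k) && bitAt a i) := by
  simp only [bitAt_eq]; exact Nat.testBit_mod_two_pow a k i

theorem bitAt_mask (k i : ℕ) : bitAt (Nat.sub (Nat.pow 2 k) 1) i = decide (i < k) := by
  simp only [bitAt_eq]; exact Nat.testBit_two_pow_sub_one k i

theorem bitAt_zero (i : ℕ) : bitAt 0 i = false := by simp [bitAt_eq]

theorem bitAt_one (i : ℕ) : bitAt 1 i = decide (i = 0) := by
  rw [bitAt_eq, Bool.eq_iff_iff]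
  simp [Nat.testBit_one_eq_true_iff_self_eq_zero]

theorem bitAt_upShifts {M d m i : ℕ} (h : bitAt (upShifts M d m) i = true) :
    ∃ k, 0 < k ∧ k ≤ m ∧ k * d ≤ i ∧ bitAt M (i - k * d) = true := by
  induction m with
  | zero => exact absurd h (by simp [upShifts, bitAt_zero])
  | succ m ih =>
    have h' : bitAt (Nat.lor (upShifts M d m) (Nat.shiftLeft M (Nat.mul (m + 1) d))) i = true := h
    rw [bitAt_lor, Bool.or_eq_true, bitAt_shiftLeft, Bool.and_eq_true, decide_eq_true_iff] at h'
    rcases h' with h' | ⟨h₁, h₂⟩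
    · obtain ⟨k, h₁, h₂, h₃⟩ := ih h'
      exact ⟨k, h₁, by omega, h₃⟩
    · exact ⟨m + 1, by omega, le_rfl, h₁, h₂⟩

theorem bitAt_downShifts {M d m i : ℕ} (h : bitAt (downShifts M d m) i = true) :
    ∃ k, 0 < k ∧ k ≤ m ∧ bitAt M (k * d + i) = true := by
  induction m with
  | zero => exact absurd h (by simp [downShifts, bitAt_zero])
  | succ m ih =>
    have h' : bitAt (Nat.lor (downShifts M d m) (Nat.shiftRight M (Nat.mul (m + 1) d))) i =
      true := h
    rw [bitAt_lor, Bool.or_eq_true, bitAt_shiftRight] at h'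
    rcases h' with h' | h'
    · obtain ⟨k, h₁, h₂, h₃⟩ := ih h'
      exact ⟨k, h₁, by omega, h₃⟩
    · exact ⟨m + 1, by omega, le_rfl, h'⟩

theorem bitAt_two_pow_32 {i : ℕ} (h : bitAt 0x100000000 i = true) : i = 32 := by
  rw [bitAt_eq, show (0x100000000 : ℕ) = 2 ^ 32 by norm_num, Nat.testBit_two_pow] at h
  exact (of_decide_eq_true h).symm

theorem dvd_or_dvd_of_commensurable {d q : ℕ} (hd : d < 32)
    (h : bitAt (commensurable d) q = true) : q ∣ d ∨ d ∣ q := by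
  have hq : q < 32 := by
    have : commensurable d = Nat.mod (Nat.shiftRight commensurableTable (Nat.mul 32 d))
      (Nat.pow 2 32) := rfl
    rw [this, bitAt_mod, Bool.and_eq_true, decide_eq_true_iff] at h
    exact h.1
  have key : ∀ d < 32, ∀ q < 32, bitAt (commensurable d) q = true → d % q = 0 ∨ q % d = 0 := by
    decide +kernel
  exact (key d hd q hq h).imp Nat.dvd_of_mod_eq_zero Nat.dvd_of_mod_eq_zero

/-! ### Counting revisits -/

namespace Stack

/-- The times on the stack. -/
def positions : Stack → List ℕ
  | nil => []
  | cons p _ _ _ rest => p :: rest.positions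

end Stack

section Count

variable {σ : Type} {s : ℕ → σ} {x : ℕ → ZMod 2}

variable (s) in
/-- The times from `t` up to `31` at which an earlier state is visited again. -/
noncomputable def revisits (t : ℕ) : Finset ℕ := (Finset.Ico t 32).filter fun u => 0 < gap s u

variable (s) in
/-- The revisits whose previous visit is at time `t` or later and is a revisit as well. -/
noncomputable def innerVisits (t : ℕ) : Finset ℕ :=
  (Finset.Ico t 32).filter fun u => 0 < gap s u ∧ t ≤ u - gap s u ∧ 0 < gap s (u - gap s u)

/-- The previous visits of revisits are distinct. Each is before `t`, hence in `l`, or is itself a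
first visit, and there are only `32 - t` minus the number of revisits of these, or belongs to an
inner visit. -/
theorem two_mul_card_revisits_le (t : ℕ) (l : List ℕ)
    (hl : ∀ u, t ≤ u → u ≤ 31 → 0 < gap s u → u - gap s u < t → u - gap s u ∈ l) :
    2 * (revisits s t).card ≤ (32 - t) + l.length + (innerVisits s t).card := by
  set A := (revisits s t).filter fun u => u - gap s u < t with hA
  set B := (revisits s t).filter fun u => ¬ u - gap s u < t with hB
  set B₀ := B.filter fun u => gap s (u - gap s u) = 0 with hB₀
  set B₂ := B.filter fun u => ¬ gap s (u - gap s u) = 0 with hB₂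
  set N := (Finset.Ico t 32).filter fun u => ¬ 0 < gap s u with hN
  have e₁ : A.card + B.card = (revisits s t).card := Finset.card_filter_add_card_filter_not _
  have e₂ : B₀.card + B₂.card = B.card := Finset.card_filter_add_card_filter_not _
  have e₃ : (revisits s t).card + N.card = 32 - t := by
    rw [← Nat.card_Ico]; exact Finset.card_filter_add_card_filter_not _
  have inj : Set.InjOn (fun u => u - gap s u) (revisits s t : Set ℕ) := by
    intro u hu v hv h
    simp only [revisits, Finset.coe_filter, Set.mem_ofPred_eq] at hu hv
    exact prev_injective hu.2 hv.2 h
  have hA' : A.card ≤ l.length := by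
    rw [← Finset.card_image_of_injOn (inj.mono (s₁ := (A : Set ℕ))
      (Finset.coe_subset.2 (Finset.filter_subset _ _)))]
    refine (Finset.card_le_card (t := l.toFinset) ?_).trans l.toFinset_card_le
    intro p hp
    simp only [hA, revisits, Finset.mem_image, Finset.mem_filter, Finset.mem_Ico] at hp
    obtain ⟨u, ⟨⟨⟨h₁, h₂⟩, h₃⟩, h₄⟩, rfl⟩ := hp
    exact List.mem_toFinset.2 (hl u h₁ (by omega) h₃ h₄)
  have hB' : B₀.card ≤ N.card := by
    rw [← Finset.card_image_of_injOn (inj.mono (s₁ := (B₀ : Set ℕ)) ?_)]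
    · refine Finset.card_le_card ?_
      intro p hp
      simp only [hB₀, hB, revisits, Finset.mem_image, Finset.mem_filter, Finset.mem_Ico] at hp
      obtain ⟨u, ⟨⟨⟨⟨h₁, h₂⟩, h₃⟩, h₄⟩, h₅⟩, rfl⟩ := hp
      simp only [hN, Finset.mem_filter, Finset.mem_Ico]
      omega
    · intro u hu
      simp only [hB₀, hB, Finset.coe_filter, Finset.mem_filter, Set.mem_ofPred_eq] at hu
      exact hu.1.1
  have hC : B₂.card ≤ (innerVisits s t).card := by
    refine Finset.card_le_card ?_
    intro u hu
    simp only [hB₂, hB, revisits, Finset.mem_filter, Finset.mem_Ico] at hu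
    simp only [innerVisits, Finset.mem_filter, Finset.mem_Ico]
    omega
  omega

/-- The labels `x` are those of the word encoded by `wordBits`. -/
def HasBits (x : ℕ → ZMod 2) : Prop :=
  ∀ i < 31, ∀ j < 31, x i = x j ↔ bitAt wordBits i = bitAt wordBits j

/-- The gaps in `F` occur only with previous visits before `p`. -/
def Excluded (s : ℕ → σ) (F p : ℕ) : Prop :=
  ∀ t ≤ 31, 0 < gap s t → bitAt F (gap s t) = true → t - gap s t < p

theorem excess_eq (G t : ℕ) : excess G t =
    excessOf G t 1 + excessOf G t 2 + excessOf G t 3 := by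
  have h : excess G t = if Nat.beq (Nat.land G 14) 14 then 0 else
    excessOf G t 1 + excessOf G t 2 + excessOf G t 3 := bite_eq _ _ _
  rw [h]
  split_ifs with hG
  · rw [Nat.beq_eq] at hG
    have key : ∀ i, bitAt 14 i = true → excessOf G t i = 0 := by
      intro i hi
      have h' := congrArg (fun M => bitAt M i) hG
      simp only [bitAt_land, hi, Bool.and_true] at h'
      simp [excessOf, bite_eq, h']
    rw [key 1 rfl, key 2 rfl, key 3 rfl]
  · rfl

theorem excessBound_antitone {d t t' : ℕ} (hd : d < 4) (h : t ≤ t') :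
    excessBound t' d ≤ excessBound t d := by
  have key : ∀ d < 4, ∀ t < 32, excessBound (t + 1) d ≤ excessBound t d := by decide +kernel
  have large : ∀ t, 32 ≤ t → excessBound t d = 0 := by
    intro t ht
    have e : ∀ m < 32, Nat.ble t m = false := by
      intro m hm; rw [ble_eq_decide]; simp; omega
    simp [excessBound, bite_eq, e]
  induction t', h using Nat.le_induction with
  | base => exact le_rfl
  | succ m _ ih =>
    refine le_trans ?_ ih
    rcases Nat.lt_or_ge m 32 with hm | hm
    · exact key d hd m hm
    · rw [large (m + 1) (by omega)]; exact Nat.zero_le _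

theorem IsRigid.bits_eq (H : IsRigid s x 31) (hx : HasBits x) {c d : ℕ} (hd : 0 < d)
    (h : gap s c = d) (h' : gap s (c + 1) = d) (hn : c < 31) :
    bitAt wordBits c = bitAt wordBits (c - d) :=
  (hx c hn (c - d) (by omega)).1 (H.label_eq_of_gap hd h h' hn)

set_option synthInstance.maxSize 1024 in
/-- The previous visit of an inner visit has the same gap `d`, so that a square of period `d` in the
word ends there. The inner visits of gap `d` lie in one factor with this period, which bounds their
number. -/
theorem card_innerVisits_le (H : IsRigid s x 31) (hx : HasBits x) {G t : ℕ}
    (hG : Excluded s G t) : (innerVisits s t).card ≤ excess G t := by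
  have hmem : ∀ u ∈ innerVisits s t, u ≤ 31 ∧ 0 < gap s u ∧ t ≤ u - gap s u ∧
      gap s (u - gap s u) = gap s u ∧ 2 * gap s u ≤ u := by
    intro u hu
    simp only [innerVisits, Finset.mem_filter, Finset.mem_Ico] at hu
    obtain ⟨⟨h₁, h₂⟩, h₃, h₄, h₅⟩ := hu
    have := H.gap_prev h₃ h₅ (by omega)
    have h₆ := (gap_spec h₅).1
    have h₇ := (gap_spec h₃).1
    exact ⟨by omega, h₃, h₄, this, by omega⟩
  have block : ∀ u ∈ innerVisits s t, ∀ v ∈ innerVisits s t, gap s v = gap s u →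
      ∀ c, u - gap s u ≤ c → c < v → bitAt wordBits c = bitAt wordBits (c - gap s u) := by
    intro u hu v hv huv c h₁ h₂
    obtain ⟨_, hu₀, -, hu₁, -⟩ := hmem u hu
    obtain ⟨hv₂, -⟩ := hmem v hv
    refine H.bits_eq hx hu₀ ?_ ?_ (by omega)
    · exact H.gap_between hu₀ hu₁ huv h₁ (by omega) (by omega)
    · exact H.gap_between hu₀ hu₁ huv (by omega) (by omega) (by omega)
  have small : ∀ u ∈ innerVisits s t, gap s u < 4 := by
    intro u hu
    by_contra hc
    have key : ∀ m < 32, ∀ d < 16, 4 ≤ d → 2 * d ≤ m →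
        ¬ ∀ i < d, bitAt wordBits (m - d + i) = bitAt wordBits (m - d + i - d) := by
      decide +kernel
    obtain ⟨h₁, -, -, -, h₂⟩ := hmem u hu
    exact key u (by omega) _ (by omega) (by omega) h₂
      fun i hi => block u hu u hu rfl _ (by omega) (by omega)
  have bound : ∀ d < 4, ((innerVisits s t).filter fun u => gap s u = d).card ≤ excessOf G t d := by
    intro d hd
    set C := (innerVisits s t).filter fun u => gap s u = d with hC
    rcases C.eq_empty_or_nonempty with h | h
    · simp [h]
    · have hm := C.min'_mem h
      have hM := C.max'_mem h
      set m := C.min' h with hm'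
      set M := C.max' h with hM'
      have hmM : m ≤ M := C.min'_le _ hM
      rw [hC, Finset.mem_filter] at hm hM
      obtain ⟨h₁, h₂, h₃, h₄, h₅⟩ := hmem m hm.1
      obtain ⟨g₁, -⟩ := hmem M hM.1
      have hbit : bitAt G d = false := by
        by_contra hc
        have := hG m h₁ h₂ (by rw [hm.2]; simpa using hc)
        omega
      have e : excessOf G t d = excessBound t d := by
        simp [excessOf, bite_eq, hbit]
      have hsub : C ⊆ Finset.Icc m M := fun u hu =>
        Finset.mem_Icc.2 ⟨C.min'_le _ hu, C.le_max' _ hu⟩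
      have hcard := Finset.card_le_card hsub
      rw [Nat.card_Icc] at hcard
      have key : ∀ d < 4, ∀ m < 32, ∀ M < 32, 0 < d → 2 * d ≤ m → m ≤ M →
          (∀ i < M - (m - d), bitAt wordBits (m - d + i) = bitAt wordBits (m - d + i - d)) →
          M + 1 - m ≤ excessBound (m - d) d := by
        decide +kernel
      have hk := key d hd m (by omega) M (by omega) (by omega) (by omega) hmM fun i hi => by
        have := block m hm.1 M hM.1 (by omega) (m - d + i) (by omega) (by omega)
        rwa [hm.2] at this
      have := excessBound_antitone (d := d) (t := t) (t' := m - d) hd (by omega)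
      omega
  have hsub : innerVisits s t ⊆ (((innerVisits s t).filter fun u => gap s u = 1) ∪
      ((innerVisits s t).filter fun u => gap s u = 2)) ∪
      ((innerVisits s t).filter fun u => gap s u = 3) := by
    intro u hu
    have h₁ := small u hu
    have h₂ := (hmem u hu).2.1
    simp only [Finset.mem_union, Finset.mem_filter, hu, true_and]
    omega
  rw [excess_eq]
  exact (Finset.card_le_card hsub).trans ((Finset.card_union_le _ _).trans (Nat.add_le_add
    ((Finset.card_union_le _ _).trans (Nat.add_le_add (bound 1 (by omega)) (bound 2 (by omega))))
    (bound 3 (by omega))))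

end Count

section Soundness

variable {σ : Type} {s : ℕ → σ} {x : ℕ → ZMod 2}

/-! ### Recorded runs and the final test -/

/-- The walk repeats itself as the recorded runs tell. -/
def Runs.Hold (s : ℕ → σ) : Runs → Prop
  | .nil => True
  | .cons t d l rest => (∀ i, t - d ≤ i → i < t - d + l → s (i + d) = s i) ∧ rest.Hold s

theorem spread_cons (t d l : ℕ) (rs : Runs) (M : ℕ) : spread (.cons t d l rs) M =
    spread rs (Nat.lor (Nat.lor M (Nat.shiftLeft (Nat.land M
      (Nat.shiftLeft (Nat.sub (Nat.pow 2 l) 1) (Nat.sub t d))) d)) (Nat.land (Nat.shiftRight M d)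
      (Nat.shiftLeft (Nat.sub (Nat.pow 2 l) 1) (Nat.sub t d)))) := by
  have h : spread (.cons t d l rs) M =
      force (Nat.shiftLeft (Nat.sub (Nat.pow 2 l) 1) (Nat.sub t d)) fun A =>
        force (Nat.lor (Nat.lor M (Nat.shiftLeft (Nat.land M A) d))
          (Nat.land (Nat.shiftRight M d) A)) (spread rs) := rfl
  rw [h, force_eq, force_eq]

/-- Whatever holds for the states at the times in `M` holds at the times in `spread rs M`. -/
theorem Runs.Hold.spread {rs : Runs} (h : rs.Hold s) {Q : σ → Prop} {M : ℕ}
    (hM : ∀ j, bitAt M j = true → Q (s j)) : ∀ j, bitAt (spread rs M) j = true → Q (s j) := by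
  induction rs generalizing M with
  | nil => exact hM
  | cons t d l rs ih =>
    obtain ⟨h₁, h₂⟩ := h
    rw [spread_cons]
    refine ih h₂ ?_
    intro j hj
    have hA : ∀ i, bitAt (Nat.shiftLeft (Nat.sub (Nat.pow 2 l) 1) (Nat.sub t d)) i = true →
        s (i + d) = s i := by
      intro i hi
      rw [bitAt_shiftLeft, bitAt_mask, Bool.and_eq_true, decide_eq_true_iff,
        decide_eq_true_iff] at hi
      have : Nat.sub t d = t - d := rfl
      exact h₁ i (by omega) (by omega)
    simp only [bitAt_lor, bitAt_land, Bool.or_eq_true, Bool.and_eq_true,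
      bitAt_shiftRight] at hj
    rcases hj with (hj | hj) | ⟨hj, hj'⟩
    · exact hM j hj
    · rw [bitAt_shiftLeft, bitAt_land, Bool.and_eq_true, Bool.and_eq_true,
        decide_eq_true_iff] at hj
      obtain ⟨h₃, h₄, h₅⟩ := hj
      have := hA _ h₅
      rw [Nat.sub_add_cancel h₃] at this
      rw [this]
      exact hM _ h₄
    · rw [← hA j hj', Nat.add_comm]
      exact hM _ hj

theorem Runs.Hold.spread_spread {rs : Runs} (h : rs.Hold s) (Q : σ → Prop) {M : ℕ}
    (hM : ∀ j, bitAt M j = true → Q (s j)) :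
    ∀ j, bitAt (_root_.spread rs (_root_.spread rs M)) j = true → Q (s j) :=
  h.spread (h.spread hM)

theorem bitAt_wordMask (j : ℕ) : bitAt 0x7fffffff j = decide (j < 31) := bitAt_mask 31 j

/-- `E` is the set of the times below `31` of one letter; its complement is that of the other letter. -/
theorem bitAt_compl (E : ℕ) (hE : E = wordBits ∨ E = Nat.sub 0x7fffffff wordBits) (j : ℕ)
    (h : bitAt (Nat.sub 0x7fffffff E) j = true) : j < 31 ∧ bitAt E j = false := by
  have small : ∀ E < 2 ^ 31, Nat.sub 0x7fffffff E < 2 ^ 31 := by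
    intro E _
    exact lt_of_le_of_lt (Nat.sub_le _ _) (by norm_num)
  have hj : j < 31 := by
    by_contra hj
    rw [bitAt_eq, Nat.testBit_lt_two_pow] at h
    · exact absurd h (by simp)
    · refine lt_of_lt_of_le (small E ?_) (Nat.pow_le_pow_right (by norm_num) (not_lt.1 hj))
      rcases hE with rfl | rfl
      · norm_num [wordBits]
      · exact small _ (by norm_num [wordBits])
  refine ⟨hj, ?_⟩
  rcases hE with rfl | rfl <;> revert h <;> revert j <;> decide +kernel

theorem deviates_succ (rs : Runs) (k W S D : ℕ) : ∃ E,
    (E = if bitAt W 0 then wordBits else Nat.sub 0x7fffffff wordBits) ∧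
    deviates rs (k + 1) W S D = deviates rs k (Nat.shiftRight W 1)
      (spread rs (spread rs (Nat.shiftLeft (Nat.land S E) 1)))
      (spread rs (spread rs (Nat.shiftLeft (Nat.lor (Nat.land D 0x7fffffff)
        (Nat.land S (Nat.sub 0x7fffffff E))) 1))) := by
  refine ⟨_, rfl, ?_⟩
  have h : deviates rs (k + 1) W S D =
      force (bite (bitAt W 0) wordBits (Nat.sub 0x7fffffff wordBits)) fun E =>
      force (spread rs (spread rs (Nat.shiftLeft (Nat.land S E) 1))) fun S' =>
      force (spread rs (spread rs (Nat.shiftLeft (Nat.lor (Nat.land D 0x7fffffff)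
        (Nat.land S (Nat.sub 0x7fffffff E))) 1))) fun D' =>
      force (Nat.shiftRight W 1) fun W' => deviates rs k W' S' D' := rfl
  rw [h, force_eq, force_eq, force_eq, force_eq, bite_eq]

theorem not_refuted (H : IsRigid s x 31) (hx : HasBits x) {rs : Runs} (h : rs.Hold s) :
    refuted rs = false := by
  -- Invariant after `i` letters: the times in `S` are reached by the word itself, those in `D` by
  -- other words.
  have main : ∀ k i W S D, i + k = 31 → (∀ j, bitAt W j = bitAt wordBits (i + j)) →
      (∀ j, bitAt S j = true → Trace s x 31 ((List.range i).map x) (s 0) (s j)) →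
      (∀ j, bitAt D j = true → ∃ w, w.length = i ∧ w ≠ (List.range i).map x ∧
        Trace s x 31 w (s 0) (s j)) → deviates rs k W S D = false := by
    intro k
    induction k with
    | zero =>
      intro i W S D hi _ _ hD
      by_contra hc
      obtain ⟨w, h₁, h₂, h₃⟩ := hD 31 (by simpa [deviates] using hc)
      obtain rfl : i = 31 := by omega
      exact h₂ (H.word_eq w h₃ h₁)
    | succ k ih =>
      intro i W S D hi hW hS hD
      obtain ⟨E, hE, e⟩ := deviates_succ rs k W S D
      have hE' : ∀ j < 31, bitAt E j = true ↔ x j = x i := by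
        intro j hj
        have h0 := hW 0
        rw [add_zero] at h0
        rw [hx j hj i (by omega), hE, h0]
        have key : ∀ i < 31, ∀ j < 31, bitAt (if bitAt wordBits i = true then wordBits
            else Nat.sub 0x7fffffff wordBits) j = true ↔ bitAt wordBits j = bitAt wordBits i := by
          decide +kernel
        exact key i (by omega) j hj
      have hE₂ : E = wordBits ∨ E = Nat.sub 0x7fffffff wordBits := by
        rw [hE]; split_ifs <;> simp
      have hElt : ∀ j, bitAt E j = true → j < 31 := by
        intro j hj
        by_contra hc
        rw [bitAt_eq, Nat.testBit_lt_two_pow] at hj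
        · exact absurd hj (by simp)
        · refine lt_of_lt_of_le (b := 2 ^ 31) ?_ (Nat.pow_le_pow_right (by norm_num) (not_lt.1 hc))
          rcases hE₂ with h | h <;> rw [h] <;> decide +kernel
      rw [e]
      have step : (List.range (i + 1)).map x = (List.range i).map x ++ [x i] := by
        simp [List.range_succ]
      refine ih (i + 1) _ _ _ (by omega) ?_ ?_ ?_
      · intro j
        rw [bitAt_shiftRight, hW]; congr 1; omega
      · refine h.spread_spread (fun u => Trace s x 31 ((List.range (i + 1)).map x) (s 0) u) ?_
        intro j hj
        rw [bitAt_shiftLeft, bitAt_land, Bool.and_eq_true, Bool.and_eq_true,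
          decide_eq_true_iff] at hj
        obtain ⟨h₁, h₂, h₃⟩ := hj
        have hj' := hElt _ h₃
        rw [step, ← (hE' _ hj').1 h₃]
        have := (hS _ h₂).append (Trace.edge hj')
        rwa [Nat.sub_add_cancel h₁] at this
      · refine h.spread_spread (fun u => ∃ w, w.length = i + 1 ∧
          w ≠ (List.range (i + 1)).map x ∧ Trace s x 31 w (s 0) u) ?_
        intro j hj
        rw [bitAt_shiftLeft, bitAt_lor, Bool.and_eq_true, decide_eq_true_iff, Bool.or_eq_true,
          bitAt_land, bitAt_land, Bool.and_eq_true, Bool.and_eq_true] at hj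
        obtain ⟨h₁, ⟨h₂, h₃⟩ | ⟨h₂, h₃⟩⟩ := hj
        · rw [bitAt_wordMask, decide_eq_true_iff] at h₃
          obtain ⟨w, g₁, g₂, g₃⟩ := hD _ h₂
          have := g₃.append (Trace.edge h₃)
          rw [Nat.sub_add_cancel h₁] at this
          refine ⟨_, by simp [g₁], ?_, this⟩
          rw [step]
          intro hc
          exact g₂ (List.append_inj_left hc (by simp [g₁]))
        · obtain ⟨h₄, h₅⟩ := bitAt_compl E hE₂ _ h₃
          have := (hS _ h₂).append (Trace.edge h₄)
          rw [Nat.sub_add_cancel h₁] at this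
          refine ⟨_, by simp, ?_, this⟩
          rw [step]
          intro hc
          have hc' := List.append_inj_right hc (by simp)
          simp only [List.cons.injEq, and_true] at hc'
          rw [(hE' _ h₄).2 hc'] at h₅
          exact absurd h₅ (by simp)
  refine main 31 0 _ _ _ rfl (fun j => by rw [Nat.zero_add]) ?_ ?_
  · refine h.spread_spread (fun u => Trace s x 31 ((List.range 0).map x) (s 0) u) ?_
    intro j hj
    rw [bitAt_one, decide_eq_true_iff] at hj
    rw [hj]
    rfl
  · intro j hj
    rw [bitAt_zero] at hj
    exact absurd hj (by simp)

end Soundness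

section Soundness

variable {σ : Type} {s : ℕ → σ} {x : ℕ → ZMod 2}

/-! ### Excluded gaps and removable lengths -/

/-- The walk up to a time from `p` on can be shortened, in a deviating way, by the lengths `32 - j` for
the bits `j` of `Z`. -/
def Removable (s : ℕ → σ) (x : ℕ → ZMod 2) (Z p : ℕ) : Prop :=
  ∀ j, bitAt Z j = true → ∃ z, z + j = 32 ∧
    ∀ i, p ≤ i → i ≤ 31 → ∃ k, k + z = i ∧ Deviates s x 31 k (s i)

/-- Any part of the walk that contains the times from `p` to `t` can be shortened by the lengths in
`Y`. -/
def Shortens (s : ℕ → σ) (x : ℕ → ZMod 2) (Y p t : ℕ) : Prop :=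
  ∀ y, bitAt Y y = true → ∀ p' ≤ p, ∀ t', t ≤ t' → t' ≤ 31 →
    ∃ k, k + y + p' = t' ∧ Reach s x 31 k (s p') (s t')

/-- The sets on the stack mean at time `t` what `Stack` says, and its times decrease, from below `b`. -/
def Stack.Good (s : ℕ → σ) (x : ℕ → ZMod 2) (t : ℕ) : ℕ → Stack → Prop
  | _, .nil => True
  | b, .cons p F Y Z rest => p < b ∧ Excluded s F p ∧ Shortens s x Y p t ∧ Removable s x Z p ∧
      rest.Good s x t p

theorem Stack.Good.mono {L : Stack} {t t' b b' : ℕ} (h : L.Good s x t b) (ht : t ≤ t')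
    (hb : b ≤ b') : L.Good s x t' b' := by
  induction L generalizing b b' with
  | nil => trivial
  | cons p F Y Z rest ih =>
    obtain ⟨h₁, h₂, h₃, h₄, h₅⟩ := h
    exact ⟨by omega, h₂, fun y hy p' hp' u hu => h₃ y hy p' hp' u (by omega), h₄,
      ih h₅ le_rfl⟩

theorem Stack.Good.lt {L : Stack} {t b q : ℕ} (h : L.Good s x t b) (hq : q ∈ L.positions) :
    q < b := by
  induction L generalizing b with
  | nil => simp [Stack.positions] at hq
  | cons p F Y Z rest ih =>
    obtain ⟨h₁, -, -, -, h₅⟩ := h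
    rw [Stack.positions, List.mem_cons] at hq
    rcases hq with rfl | hq
    · exact h₁
    · exact (ih h₅ hq).trans h₁

theorem Excluded.lor {F F' p : ℕ} (h : Excluded s F p) (h' : Excluded s F' p) :
    Excluded s (Nat.lor F F') p := by
  intro t ht h₀ hb
  rw [bitAt_lor, Bool.or_eq_true] at hb
  exact hb.elim (h t ht h₀) (h' t ht h₀)

theorem Excluded.mono {F p p' : ℕ} (h : Excluded s F p) (hp : p ≤ p') : Excluded s F p' :=
  fun t ht h₀ hb => (h t ht h₀ hb).trans_le hp

theorem Shortens.lor {Y Y' p t : ℕ} (h : Shortens s x Y p t) (h' : Shortens s x Y' p t) :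
    Shortens s x (Nat.lor Y Y') p t := by
  intro y hb
  rw [bitAt_lor, Bool.or_eq_true] at hb
  exact hb.elim (h y) (h' y)

theorem Shortens.mono {Y p p' t t' : ℕ} (h : Shortens s x Y p t) (hp : p' ≤ p) (ht : t ≤ t') :
    Shortens s x Y p' t' :=
  fun y hy q hq u hu => h y hy q (hq.trans hp) u (ht.trans hu)

theorem Removable.lor {Z Z' p : ℕ} (h : Removable s x Z p) (h' : Removable s x Z' p) :
    Removable s x (Nat.lor Z Z') p := by
  intro j hb
  rw [bitAt_lor, Bool.or_eq_true] at hb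
  exact hb.elim (h j) (h' j)

theorem Removable.mono {Z p p' : ℕ} (h : Removable s x Z p) (hp : p ≤ p') :
    Removable s x Z p' := by
  intro j hj
  obtain ⟨z, hz, h'⟩ := h j hj
  exact ⟨z, hz, fun i hi => h' i (hp.trans hi)⟩

theorem addTop_cons (M p F Y Z : ℕ) (rest : Stack) :
    addTop M (.cons p F Y Z rest) = .cons p F (Nat.lor Y M) Z rest := by
  have h : addTop M (.cons p F Y Z rest) =
    force (Nat.lor Y M) fun Y' => .cons p F Y' Z rest := rfl
  rw [h, force_eq]

theorem positions_addTop (M : ℕ) (L : Stack) : (addTop M L).positions = L.positions := by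
  cases L with
  | nil => rfl
  | cons => rw [addTop_cons]; rfl

theorem Stack.Good.addTop {L : Stack} {t b M q : ℕ} (h : L.Good s x t b) (hb : b ≤ q)
    (hM : Shortens s x M q t) : (addTop M L).Good s x t b := by
  cases L with
  | nil => trivial
  | cons p F Y Z rest =>
    obtain ⟨h₁, h₂, h₃, h₄, h₅⟩ := h
    rw [addTop_cons]
    exact ⟨h₁, h₂, h₃.lor (hM.mono (by omega) le_rfl), h₄, h₅⟩

/-! ### The laws for a completed run -/

namespace IsRun

variable {t d l : ℕ} (R : IsRun s 31 t d l)
include R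

/-- After the end of a run, the step out of its last state is not the step that the run repeated. -/
theorem ne_of_end (H : IsRigid s x 31) (h : t + l ≤ 31) : s (t + l - d) ≠ s (t + l) := by
  intro hs
  have hl := R.len
  have h₁ := R.gap_eq (l - 1) (by omega)
  refine R.maximal h ?_
  have := H.gap_succ R.pos h₁ (by rwa [show t + (l - 1) + 1 = t + l by omega]) (by omega)
  rwa [show t + (l - 1) + 1 = t + l by omega] at this

/-- Leaving out `k` of the loops of a run shortens the walk, and makes it deviate: right after the end
of the run, it is in another state than the walk was at that time. -/
theorem deviates (H : IsRigid s x 31) {k : ℕ} (hk : 0 < k) (hkl : k * d < d + l) {i : ℕ}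
    (hi : t + l ≤ i) (hi' : i ≤ 31) : Deviates s x 31 (i - k * d) (s i) := by
  have hl := R.len
  have hd := R.pos
  have hdt := R.d_le
  have hkd : d ≤ k * d := Nat.le_mul_of_pos_left d hk
  have e₁ : s (t + l - 1 - k * d) = s (t + l - 1) := by
    have := R.eq_add_mul (j := t + l - 1 - k * d) k (by omega) (by omega)
    rw [Nat.sub_add_cancel (by omega)] at this
    exact this.symm
  have e₂ : s (t + l - k * d) = s (t + l - d) := by
    have := R.eq_add_mul (j := t + l - k * d) (k - 1) (by omega)
      (by rw [Nat.sub_mul, one_mul]; omega)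
    rw [← this, Nat.sub_mul, one_mul]; congr 1; omega
  refine ⟨t + l - k * d, i - (t + l), s (t + l), by omega, ?_, ?_, reach_segment hi hi'⟩
  · have r₁ := reach_segment (s := s) (x := x) (n := 31) (Nat.zero_le (t + l - 1 - k * d))
      (by omega)
    have r₂ := reach_segment (s := s) (x := x) (n := 31) (i := t + l - 1) (j := t + l) (by omega)
      (by omega)
    rw [e₁] at r₁
    have := r₁.trans r₂
    rwa [show t + l - 1 - k * d - 0 + (t + l - (t + l - 1)) = t + l - k * d by omega] at this
  · rw [e₂]; exact (R.ne_of_end H (by omega)).symm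

theorem mul_le_of_le_div {k : ℕ} (hk : k ≤ (d + l - 1) / d) : k * d < d + l := by
  have := (Nat.le_div_iff_mul_le R.pos).1 hk
  have := R.len
  omega

/-- Loops of a run can be left out alone, or after a deviating shortcut that ends where the run begins
to repeat itself. -/
theorem removable (H : IsRigid s x 31) {Z : ℕ} (hZ : Removable s x Z (t - d)) :
    Removable s x (downShifts (Nat.lor Z 0x100000000) d ((d + l - 1) / d)) (t + l) := by
  intro j hj
  obtain ⟨k, hk, hkm, hb⟩ := bitAt_downShifts hj
  have hkl := R.mul_le_of_le_div hkm
  have hdt := R.d_le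
  have hle := R.le
  rw [bitAt_lor, Bool.or_eq_true] at hb
  rcases hb with hb | hb
  · obtain ⟨z, hz, hdev⟩ := hZ _ hb
    obtain ⟨k', hk', hdev'⟩ := hdev (t - d) le_rfl (by omega)
    refine ⟨z + k * d, by omega, fun i hi hi' => ⟨i - (z + k * d), by omega, ?_⟩⟩
    rw [← R.eq_add_mul (j := t - d) k le_rfl (by omega)] at hdev'
    have := hdev'.trans (reach_segment (i := t - d + k * d) (j := i) (by omega) hi')
    rwa [show k' + (i - (t - d + k * d)) = i - (z + k * d) by omega] at this
  · have := bitAt_two_pow_32 hb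
    exact ⟨k * d, this, fun i hi hi' =>
      ⟨i - k * d, by omega, R.deviates H hk hkl hi hi'⟩⟩

theorem shortens : Shortens s x (upShifts 1 d ((d + l - 1) / d)) (t - d) (t + l) := by
  intro y hy p hp t' ht' ht''
  obtain ⟨k, hk, hkm, hky, hb⟩ := bitAt_upShifts hy
  have hkl := R.mul_le_of_le_div hkm
  have hdt := R.d_le
  rw [bitAt_one, decide_eq_true_iff] at hb
  refine ⟨t' - p - y, by omega, ?_⟩
  have r₁ := reach_segment (s := s) (x := x) (n := 31) hp (by omega)
  have r₂ := reach_segment (s := s) (x := x) (n := 31) (i := t - d + k * d) (j := t') (by omega) ht''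
  rw [R.eq_add_mul k le_rfl (by omega)] at r₂
  have := r₁.trans r₂
  rwa [show t - d - p + (t' - (t - d + k * d)) = t' - p - y by omega] at this

/-- Behind a run of gap `d`, no gap divides `d` or is a multiple of it: loops of the one kind
could be exchanged for loops of the other kind. -/
theorem excluded (H : IsRigid s x 31) :
    Excluded s (commensurable d) (t + l) := by
  intro u hu h₀ hb
  by_contra hc
  obtain ⟨h₁, h₂⟩ := gap_spec h₀
  have hd := R.pos
  have hl := R.len
  have hdt := R.d_le
  have hle := R.le
  have loop := reach_segment (s := s) (x := x) (n := 31) (i := u - gap s u) (j := u) (by omega) hu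
  rw [← h₂, show u - (u - gap s u) = gap s u by omega] at loop
  rcases dvd_or_dvd_of_commensurable (by omega) hb with ⟨m, hm⟩ | ⟨m, hm⟩
  · have dev := R.deviates H (k := 1) one_pos (by omega) (i := u - gap s u) (by omega) (by omega)
    have := dev.trans (loop.iterate m)
    rw [one_mul, Nat.mul_comm m, ← hm, Nat.sub_add_cancel (by omega)] at this
    exact H.not_deviates (by omega) this
  · have hm₀ : 0 < m := Nat.pos_of_ne_zero (by rintro rfl; omega)
    have e₁ := R.eq_sub (i := l - 1) (by omega)
    rw [show t + (l - 1) = t + l - 1 by omega] at e₁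
    have r₁ := reach_segment (s := s) (x := x) (n := 31) (Nat.zero_le (t + l - 1)) (by omega)
    have r₂ := reach_segment (s := s) (x := x) (n := 31) (i := t + l - 1 - d) (j := t + l - d)
      (by omega) (by omega)
    have r₃ := reach_segment (s := s) (x := x) (n := 31) (i := t + l - d) (j := t + l - 1)
      (by omega) (by omega)
    have lp := reach_segment (s := s) (x := x) (n := 31) (i := t + l - 1 - d) (j := t + l - 1)
      (by omega) (by omega)
    have r₄ := reach_segment (s := s) (x := x) (n := 31) (i := t + l - 1) (j := u - gap s u)
      (by omega) (by omega)
    rw [e₁, show t + l - 1 - (t + l - 1 - d) = d by omega] at lp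
    rw [e₁] at r₂
    have q₁ := r₁.trans r₂
    rw [show t + l - 1 - 0 + (t + l - d - (t + l - 1 - d)) = t + l by omega] at q₁
    have dev : Deviates s x 31 (t + l + (d - 1)) (s (t + l - 1)) := by
      refine ⟨t + l, d - 1, _, rfl, q₁, R.ne_of_end H (by omega), ?_⟩
      rwa [show t + l - 1 - (t + l - d) = d - 1 by omega] at r₃
    have := (dev.trans (lp.iterate (m - 1))).trans r₄
    rw [h₂] at this
    have e : (m - 1) * d = gap s u - d := by rw [Nat.sub_mul, one_mul, hm, Nat.mul_comm d m]
    have hge : d ≤ gap s u := by rw [hm]; exact Nat.le_mul_of_pos_right d hm₀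
    rw [e, show t + l + (d - 1) + (gap s u - d) + (u - gap s u - (t + l - 1)) = u by omega] at this
    exact H.not_deviates hu this

/-- The states visited during a run are not visited after its end. -/
theorem prev_lt (H : IsRigid s x 31) {u : ℕ} (hu : t + l ≤ u) (hu' : u ≤ 31)
    (h₀ : 0 < gap s u) (hp : u - gap s u < t + l) : u - gap s u < t - d := by
  obtain ⟨h₁, h₂⟩ := gap_spec h₀
  have hd := R.pos
  have hl := R.len
  have hdt := R.d_le
  by_contra hc
  have key : ∃ a, t ≤ a ∧ a < t + l ∧ a - d < u - gap s u ∧ u - gap s u ≤ a := by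
    rcases Nat.lt_or_ge (u - gap s u) t with h | h
    · refine ⟨t, le_rfl, by omega, ?_, by omega⟩
      refine lt_of_le_of_ne (by omega) fun he => ?_
      have h₃ := R.gap_eq 0 hl
      rw [add_zero] at h₃
      have := prev_injective (s := s) (t := t) (t' := u) (by omega) h₀ (by rw [h₃, he])
      omega
    · exact ⟨u - gap s u, h, hp, by omega, le_rfl⟩
  obtain ⟨a, g₁, g₂, g₃, g₄⟩ := key
  have ga := R.gap_eq (a - t) (by omega)
  rw [Nat.add_sub_cancel' g₁] at ga
  have e := H.gap_eq_of_cross (a := a) (b := u) (by omega) h₀ (by omega) g₄ (by omega) hu'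
  exact R.maximal (by omega) (H.gap_between hd ga (by omega) (by omega) hu hu')

/-- The word has no factor of length `d + 5` with period `d`. -/
theorem len_le (H : IsRigid s x 31) (hx : HasBits x) : l ≤ 5 := by
  by_contra hc
  have key : ∀ a < 27, ∀ d < 32, 0 < d → d ≤ a →
      ¬ ∀ i < 5, bitAt wordBits (a + i) = bitAt wordBits (a + i - d) := by decide +kernel
  have hle := R.le
  have hdt := R.d_le
  refine key t (by omega) d (by omega) R.pos hdt fun i hi => ?_
  exact H.bits_eq hx R.pos (R.gap_eq i (by omega))
    (by rw [Nat.add_assoc]; exact R.gap_eq (i + 1) (by omega)) (by omega)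

theorem hold {rs : Runs} (h : rs.Hold s) : (Runs.cons t d l rs).Hold s := by
  have := R.d_le
  exact ⟨fun i h₁ h₂ => R.eq_add h₁ (by omega), h⟩

end IsRun

theorem exists_isRun {t : ℕ} (h : 0 < gap s t) (ht : t ≤ 31) : ∃ l, IsRun s 31 t (gap s t) l := by
  classical
  have hex : ∃ l, 0 < l ∧ (t + l = 32 ∨ gap s (t + l) ≠ gap s t) := ⟨32 - t, by omega, by omega⟩
  obtain ⟨h₁, h₂⟩ := Nat.find_spec hex
  refine ⟨Nat.find hex, h, h₁, ?_, ?_, fun h₃ => by omega⟩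
  · intro i hi
    rcases Nat.eq_zero_or_pos i with rfl | h0
    · rfl
    · have := Nat.find_min hex hi
      by_contra hc
      exact this ⟨h0, Or.inr hc⟩
  · by_contra hc
    have := Nat.find_min hex (m := 32 - t) (by omega)
    exact this ⟨by omega, by omega⟩

/-- Otherwise a deviating walk, shorter by `z`, to `s t` could be continued by the loop from `s t`
back to it, shortened by `y`, where `z + y` is the gap. -/
theorem admissible_of_gap (H : IsRigid s x 31) {t F Y Z : ℕ} (h : 0 < gap s t) (ht : t ≤ 31)
    (hF : Excluded s F (t - gap s t)) (hY : Shortens s x Y (t - gap s t) t)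
    (hZ : Removable s x Z t) : admissible (gap s t) F Y Z = true := by
  obtain ⟨h₁, h₂⟩ := gap_spec h
  have e : admissible (gap s t) F Y Z = ((!bitAt F (gap s t)) &&
      decide (Nat.land Y (Nat.shiftRight Z (32 - gap s t)) = 0)) := by
    unfold admissible
    rw [band_eq, bneg_eq, natBeq_eq_decide]
    rfl
  rw [e, Bool.and_eq_true, Bool.not_eq_true', decide_eq_true_iff]
  constructor
  · by_contra hc
    have := hF t ht h (by simpa using hc)
    omega
  · refine Nat.eq_of_testBit_eq fun y => ?_
    rw [← bitAt_eq, Nat.zero_testBit, bitAt_land, bitAt_shiftRight]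
    by_contra hc
    rw [Bool.not_eq_false, Bool.and_eq_true] at hc
    obtain ⟨k, hk, hr⟩ := hY y hc.1 _ le_rfl t le_rfl ht
    obtain ⟨z, hz, hdev⟩ := hZ _ hc.2
    obtain ⟨k', hk', hdev⟩ := hdev t le_rfl ht
    rw [← h₂] at hdev
    have := hdev.trans hr
    rw [show k' + k = t by omega] at this
    exact H.not_deviates ht this

end Soundness

section Soundness

variable {σ : Type} {s : ℕ → σ} {x : ℕ → ZMod 2}

/-! ### Soundness of the search -/
theorem tryRun_succ (k : ℕ → ℕ → Bool) (det : Bool) (t p B f l t' y : ℕ) :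
    tryRun k det t p B (f + 1) l t' y =
      (((!det || (bitAt y 0 || decide (t' = 32))) && k l t') ||
        (!bitAt y 0 && (decide (t' ≤ 31) && ((decide (t ≤ p + l) || bitAt B (p + l)) &&
          tryRun k det t p B f (l + 1) (t' + 1) (Nat.shiftRight y 1))))) := by
  have h : tryRun k det t p B (f + 1) l t' y =
    bor (band (bor (bneg det) (bor (bitAt y 0) (Nat.beq t' 32))) (k l t'))
      (band (bneg (bitAt y 0)) (band (Nat.ble t' 31)
        (band (bor (Nat.ble t (Nat.add p l)) (bitAt B (Nat.add p l)))
          (force (Nat.succ l) fun l' => force (Nat.succ t') fun t'' =>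
            force (Nat.shiftRight y 1) fun y' => tryRun k det t p B f l' t'' y')))) := rfl
  rw [h]
  simp only [force_eq, bor_eq, band_eq, bneg_eq, natBeq_eq_decide, ble_eq_decide]
  rfl

/-- The length of the run at `t` is among those that `tryRun` tries. -/
theorem tryRun_of_isRun (H : IsRigid s x 31) (hx : HasBits x) {det : Bool}
    (hdet : det = true → IsDeterministic s x 31) {k : ℕ → ℕ → Bool} {t d m B : ℕ}
    (R : IsRun s 31 t d m) (hB : ∀ i < m, t ≤ t - d + i ∨ bitAt B (t - d + i) = true)
    (hk : k m (t + m) = true) (f l y : ℕ) (hl : 0 < l) (hlm : l ≤ m) (hf : m < f + l)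
    (hy : ∀ i, bitAt y i =
      (bitAt wordBits (t + l - 1 + i) ^^ bitAt wordBits (t - d + l - 1 + i))) :
    tryRun k det t (t - d) B f l (t + l) y = true := by
  induction f generalizing l y with
  | zero => omega
  | succ f ih =>
    have hdt := R.d_le
    have hd := R.pos
    have hle := R.le
    have hy0 := hy 0
    rw [add_zero, add_zero, show t - d + l - 1 = t + l - 1 - d by omega] at hy0
    rw [tryRun_succ, Bool.or_eq_true]
    rcases Nat.lt_or_ge l m with h | h
    · right
      have e := H.bits_eq hx hd (R.gap_eq (l - 1) (by omega))
        (by rw [show t + (l - 1) + 1 = t + l by omega]; exact R.gap_eq l h) (by omega)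
      rw [show t + (l - 1) = t + l - 1 by omega] at e
      rw [e, Bool.xor_self] at hy0
      have := ih (l + 1) (Nat.shiftRight y 1) (by omega) (by omega) (by omega) fun i => by
        rw [bitAt_shiftRight, hy]
        congr 2 <;> omega
      rw [hy0, show t + l + 1 = t + (l + 1) by omega, this, decide_eq_true (by omega : t + l ≤ 31)]
      rcases hB l h with h' | h' <;> simp [h']
    · obtain rfl : l = m := by omega
      left
      rw [hk, Bool.and_true, Bool.or_eq_true]
      by_cases h32 : t + l = 32
      · right; simp [h32]
      cases det with
      | false => left; rfl
      | true =>
        right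
        have hD := hdet rfl
        rw [Bool.or_eq_true]; left
        by_contra hc
        replace hc : bitAt wordBits (t + l - 1) = bitAt wordBits (t + l - 1 - d) := by
          rw [hy0] at hc
          revert hc
          cases bitAt wordBits (t + l - 1) <;> cases bitAt wordBits (t + l - 1 - d) <;> simp
        have e₁ := (hx (t + l - 1) (by omega) (t + l - 1 - d) (by omega)).2 hc
        have e₂ := R.eq_sub (i := l - 1) (by omega)
        rw [show t + (l - 1) = t + l - 1 by omega] at e₂
        have e₃ := hD _ (by omega) _ (by omega) e₂.symm e₁
        rw [show t + l - 1 + 1 = t + l by omega,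
          show t + l - 1 - d + 1 = t + l - d by omega] at e₃
        exact R.ne_of_end H (by omega) e₃.symm

theorem tryGaps_cons (k : ℕ → ℕ → ℕ → Stack → ℕ → ℕ → ℕ → ℕ → Bool) (det : Bool)
    (t b Z B p F Y Zp : ℕ) (rest : Stack) (a h : ℕ) :
    tryGaps k det t b Z B (.cons p F Y Zp rest) a h = if h < b then false else
      ((admissible (t - p) F (Nat.lor a Y) Z &&
        tryRun (k (t - p) p Zp rest h (Nat.lor a Y)) det t p B 31 1 (t + 1)
          (Nat.xor (Nat.shiftRight wordBits t) (Nat.shiftRight wordBits p))) ||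
      tryGaps k det t b Z B rest (Nat.lor a Y) (h - 1)) := by
  have e : tryGaps k det t b Z B (.cons p F Y Zp rest) a h = bite (ltb h b) false
      (force (Nat.lor a Y) fun a' =>
        bor (force (Nat.sub t p) fun d => band (admissible d F a' Z)
          (force (Nat.xor (Nat.shiftRight wordBits t) (Nat.shiftRight wordBits p)) fun y =>
            force (Nat.succ t) fun t' => tryRun (k d p Zp rest h a') det t p B 31 1 t' y))
        (force (Nat.sub h 1) fun h' => tryGaps k det t b Z B rest a' h')) := rfl
  rw [e]
  simp only [force_eq, bor_eq, band_eq, bite_eq, ltb_eq, decide_eq_true_eq]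
  rfl

/-- The gap at `t` is among those that `tryGaps` tries. -/
theorem tryGaps_of_gap (H : IsRigid s x 31) {det : Bool}
    {k : ℕ → ℕ → ℕ → Stack → ℕ → ℕ → ℕ → ℕ → Bool} {t b Z B : ℕ} (h₀ : 0 < gap s t)
    (ht : t ≤ 31) (hZ : Removable s x Z t) {L : Stack} {c a h : ℕ} (hL : L.Good s x t c)
    (hmem : t - gap s t ∈ L.positions) (ha : ∀ q < c, Shortens s x a q t)
    (hh : L.positions.length ≤ h + 1)
    (hb : ∀ l : List ℕ, (∀ q ∈ L.positions, q < t - gap s t → q ∈ l) → b ≤ l.length)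
    (hk : ∀ Zp rest h a, Removable s x Zp (t - gap s t) → rest.Good s x t (t - gap s t) →
      Shortens s x a (t - gap s t) t → rest.positions.length ≤ h →
      (∀ q ∈ L.positions, q < t - gap s t → q ∈ rest.positions) →
      tryRun (k (gap s t) (t - gap s t) Zp rest h a) det t (t - gap s t) B 31 1 (t + 1)
        (Nat.xor (Nat.shiftRight wordBits t) (Nat.shiftRight wordBits (t - gap s t))) = true) :
    tryGaps k det t b Z B L a h = true := by
  induction L generalizing c a h with
  | nil => simp [Stack.positions] at hmem
  | cons p F Y Zp rest ih =>
    obtain ⟨h₁, h₂, h₃, h₄, h₅⟩ := hL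
    have hgt := (gap_spec h₀).1
    rw [Stack.positions, List.length_cons] at hh
    rw [Stack.positions, List.mem_cons] at hmem
    have hlow : ∀ q ∈ (Stack.cons p F Y Zp rest).positions, q < t - gap s t →
        q ∈ rest.positions := by
      intro q hq hqt
      rw [Stack.positions, List.mem_cons] at hq
      rcases hq with rfl | hq
      · rcases hmem with h' | h'
        · omega
        · have := h₅.lt h'; omega
      · exact hq
    have hbh : ¬ h < b := by
      have := hb rest.positions hlow
      omega
    have ha' : Shortens s x (Nat.lor a Y) p t := (ha p h₁).lor h₃
    rw [tryGaps_cons, if_neg hbh, Bool.or_eq_true, Bool.and_eq_true]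
    by_cases hp : t - gap s t = p
    · left
      subst hp
      rw [Nat.sub_sub_self hgt]
      exact ⟨admissible_of_gap H h₀ ht h₂ ha' hZ, hk _ _ _ _ h₄ h₅ ha' (by omega) hlow⟩
    · right
      have hmem' := hmem.resolve_left hp
      refine ih h₅ hmem' (fun q hq => ha'.mono hq.le le_rfl) (by omega) ?_ ?_
      · intro l hl
        exact hb l fun q hq hqt => hl q (hlow q hq hqt) hqt
      · intro Zp' rest' h' a'' g₁ g₂ g₃ g₄ g₅
        exact hk _ _ _ _ g₁ g₂ g₃ g₄ fun q hq hqt => g₅ q (hlow q hq hqt) hqt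

theorem prune_eq (K c t h P : ℕ) :
    prune K c t h P = (decide (c + (h + P) < K) || decide (c + (32 - t) < K)) := by
  unfold prune
  rw [bor_eq, ltb_eq, ltb_eq]
  rfl

theorem close_eq (next : ℕ → ℕ → ℕ → Stack → ℕ → ℕ → ℕ → Runs → Bool)
    (K P t c B G Z : ℕ) (rs : Runs) (d p Zp : ℕ) (rest : Stack) (h a l t' : ℕ) :
    close next K P t c B G Z rs d p Zp rest h a l t' =
      if prune K (c + l) t' h P = true then false else
        next t' (c + l) h (addTop (Nat.lor a (upShifts 1 d ((d + l - 1) / d))) rest)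
          (Nat.mod B (Nat.pow 2 p)) (Nat.lor G (commensurable d))
          (Nat.lor Z (downShifts (Nat.lor Zp 0x100000000) d ((d + l - 1) / d)))
          (.cons t d l rs) := by
  unfold close
  simp only [force_eq, bite_eq]
  rfl

theorem search_succ (det : Bool) (K f t c h : ℕ) (L : Stack) (B G Z : ℕ) (rs : Runs) :
    search det K (f + 1) t c h L B G Z rs =
      if prune K c t h (excess G t) = true then false else if t = 32 then !refuted rs else
        (tryGaps (close (search det K f) K (excess G t) t c B G Z rs) det t
          (K - (c + excess G t + 5)) Z B L 0 (h - 1) ||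
        search det K f (t + 1) (c - 1) (h + 1) (.cons t G 0 Z L)
          (Nat.lor B (Nat.shiftLeft 1 t)) G Z rs) := by
  have e : search det K (f + 1) t c h L B G Z rs =
    force (excess G t) fun P =>
    bite (prune K c t h P) false (bite (Nat.beq t 32) (bneg (refuted rs))
      (bor (force (Nat.sub K (Nat.add (Nat.add c P) 5)) fun b =>
          tryGaps (close (search det K f) K P t c B G Z rs) det t b Z B L 0 (Nat.sub h 1))
        (force (Nat.succ t) fun t' => force (Nat.lor B (Nat.shiftLeft 1 t)) fun B' =>
          search det K f t' (Nat.sub c 1) (Nat.succ h) (.cons t G 0 Z L) B' G Z rs))) := rfl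
  rw [e]
  simp only [force_eq, bite_eq, bor_eq, bneg_eq, natBeq_eq_decide, decide_eq_true_eq]
  rfl

/-- The invariant of the search, when it has followed the gap function of `s` up to time `t`. The
condition `count` says that `s` has at least `K / 2` revisits. -/
structure SearchState (s : ℕ → σ) (x : ℕ → ZMod 2) (K t c h : ℕ) (L : Stack) (B G Z : ℕ)
    (rs : Runs) : Prop where
  le : t ≤ 32
  count : K + (32 - t) ≤ c + 2 * (revisits s t).card
  length : L.positions.length ≤ h
  good : L.Good s x t t
  prev_mem : ∀ u, t ≤ u → u ≤ 31 → 0 < gap s u → u - gap s u < t →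
    u - gap s u ∈ L.positions ∧ bitAt B (u - gap s u) = true
  excluded : Excluded s G t
  removable : Removable s x Z t
  hold : rs.Hold s

theorem revisits_succ_of_eq_zero {t : ℕ} (h : gap s t = 0) : revisits s (t + 1) = revisits s t := by
  ext u
  simp only [revisits, Finset.mem_filter, Finset.mem_Ico]
  constructor
  · rintro ⟨⟨h₁, h₂⟩, h₃⟩
    exact ⟨⟨by omega, h₂⟩, h₃⟩
  · rintro ⟨⟨h₁, h₂⟩, h₃⟩
    refine ⟨⟨Nat.lt_of_le_of_ne h₁ ?_, h₂⟩, h₃⟩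
    rintro rfl
    omega

theorem IsRun.card_revisits {t d l : ℕ} (R : IsRun s 31 t d l) :
    (revisits s t).card = l + (revisits s (t + l)).card := by
  have hle := R.le
  have e : revisits s t = Finset.Ico t (t + l) ∪ revisits s (t + l) := by
    ext u
    simp only [revisits, Finset.mem_union, Finset.mem_filter, Finset.mem_Ico]
    constructor
    · rintro ⟨⟨h₁, h₂⟩, h₃⟩
      omega
    · rintro (⟨h₁, h₂⟩ | ⟨⟨h₁, h₂⟩, h₃⟩)
      · have := R.gap_eq (u - t) (by omega)
        rw [Nat.add_sub_cancel' h₁] at this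
        have := R.pos
        exact ⟨⟨h₁, by omega⟩, by omega⟩
      · exact ⟨⟨by omega, h₂⟩, h₃⟩
  rw [e, Finset.card_union_of_disjoint, Nat.card_Ico, Nat.add_sub_cancel_left]
  rw [Finset.disjoint_left]
  intro u hu hu'
  simp only [revisits, Finset.mem_filter, Finset.mem_Ico] at hu hu'
  omega

theorem innerVisits_subset {t t' : ℕ} (h : t ≤ t') : innerVisits s t' ⊆ innerVisits s t := by
  intro u hu
  simp only [innerVisits, Finset.mem_filter, Finset.mem_Ico] at hu ⊢
  omega

theorem SearchState.prune_eq_false (H : IsRigid s x 31) (hx : HasBits x) {K t c h : ℕ} {L : Stack}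
    {B G Z : ℕ} {rs : Runs} (S : SearchState s x K t c h L B G Z rs) :
    prune K c t h (excess G t) = false := by
  have h₁ := two_mul_card_revisits_le (s := s) t L.positions
    fun u hu hu' h₀ hp => (S.prev_mem u hu hu' h₀ hp).1
  have h₂ := card_innerVisits_le H hx S.excluded
  have h₃ : (revisits s t).card ≤ 32 - t :=
    (Finset.card_filter_le _ _).trans_eq (Nat.card_Ico _ _)
  have h₄ := S.count
  have h₅ := S.length
  rw [prune_eq, Bool.or_eq_false_iff, decide_eq_false_iff_not, decide_eq_false_iff_not]
  omega

/-- The state at time `t` is new. -/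
theorem SearchState.push {K t c h : ℕ} {L : Stack} {B G Z : ℕ} {rs : Runs}
    (S : SearchState s x K t c h L B G Z rs) (ht : t ≤ 31) (h₀ : gap s t = 0) :
    SearchState s x K (t + 1) (c - 1) (h + 1) (.cons t G 0 Z L) (Nat.lor B (Nat.shiftLeft 1 t))
      G Z rs where
  le := by omega
  count := by
    have := S.count
    rw [revisits_succ_of_eq_zero h₀]
    omega
  length := by
    have := S.length
    rw [Stack.positions, List.length_cons]
    omega
  good := ⟨Nat.lt_succ_self t, S.excluded,
    fun y hy => absurd hy (by simp [bitAt_zero]), S.removable, S.good.mono (by omega) le_rfl⟩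
  prev_mem := by
    intro u hu hu' h₁ hp
    rw [Stack.positions, List.mem_cons, bitAt_lor, bitAt_shiftLeft, bitAt_one]
    rcases Nat.lt_or_ge (u - gap s u) t with h | h
    · obtain ⟨g₁, g₂⟩ := S.prev_mem u (by omega) hu' h₁ h
      exact ⟨Or.inr g₁, by rw [g₂, Bool.true_or]⟩
    · have e : u - gap s u = t := by omega
      rw [e]
      exact ⟨Or.inl rfl, by simp⟩
  excluded := S.excluded.mono (by omega)
  removable := S.removable.mono (by omega)
  hold := S.hold

/-- A run starts at time `t`. -/
theorem SearchState.close (H : IsRigid s x 31) {K t c h h' l a : ℕ} {L rest : Stack}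
    {B G Z Zp : ℕ} {rs : Runs} (S : SearchState s x K t c h L B G Z rs)
    (R : IsRun s 31 t (gap s t) l) (hZp : Removable s x Zp (t - gap s t))
    (hrest : rest.Good s x t (t - gap s t)) (ha : Shortens s x a (t - gap s t) t)
    (hlen : rest.positions.length ≤ h')
    (hmem : ∀ q ∈ L.positions, q < t - gap s t → q ∈ rest.positions) :
    SearchState s x K (t + l) (c + l) h'
      (addTop (Nat.lor a (upShifts 1 (gap s t) ((gap s t + l - 1) / gap s t))) rest)
      (Nat.mod B (Nat.pow 2 (t - gap s t))) (Nat.lor G (commensurable (gap s t)))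
      (Nat.lor Z (downShifts (Nat.lor Zp 0x100000000) (gap s t)
        ((gap s t + l - 1) / gap s t))) (.cons t (gap s t) l rs) where
  le := R.le
  count := by
    have h₁ := S.count
    have h₂ := R.card_revisits
    have h₃ := R.le
    omega
  length := by rwa [positions_addTop]
  good := (hrest.mono (Nat.le_add_right t l) (by omega : t - gap s t ≤ t - gap s t)).addTop le_rfl
    ((ha.mono le_rfl (Nat.le_add_right t l)).lor R.shortens) |>.mono le_rfl (by omega)
  prev_mem := by
    intro u hu hu' h₀ hp
    have h₁ := R.prev_lt H hu hu' h₀ hp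
    obtain ⟨g₁, g₂⟩ := S.prev_mem u (by omega) hu' h₀ (by omega)
    rw [positions_addTop, bitAt_mod, g₂, decide_eq_true h₁]
    exact ⟨hmem _ g₁ h₁, rfl⟩
  excluded := (S.excluded.mono (Nat.le_add_right t l)).lor (R.excluded H)
  removable := (S.removable.mono (Nat.le_add_right t l)).lor (R.removable H hZp)
  hold := R.hold S.hold

theorem SearchState.search_eq_true (H : IsRigid s x 31) (hx : HasBits x) {det : Bool}
    (hdet : det = true → IsDeterministic s x 31) {K : ℕ} (f : ℕ) {t c h : ℕ} {L : Stack}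
    {B G Z : ℕ} {rs : Runs} (S : SearchState s x K t c h L B G Z rs) (hf : 33 ≤ t + f) :
    search det K f t c h L B G Z rs = true := by
  induction f generalizing t c h L B G Z rs with
  | zero => have := S.le; omega
  | succ f ih =>
    rw [search_succ, S.prune_eq_false H hx]
    rw [if_neg (by simp)]
    split_ifs with ht
    · rw [not_refuted H hx S.hold]; rfl
    have ht' : t ≤ 31 := by have := S.le; omega
    rw [Bool.or_eq_true]
    rcases Nat.eq_zero_or_pos (gap s t) with h₀ | h₀
    · exact Or.inr (ih (S.push ht' h₀) (by omega))
    · left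
      obtain ⟨l, R⟩ := exists_isRun h₀ ht'
      have hl := R.len
      have hgt := (gap_spec h₀).1
      have hinner := (Finset.card_le_card (innerVisits_subset (s := s)
        (Nat.le_add_right t l))).trans (card_innerVisits_le H hx S.excluded)
      have hcount := S.count
      have hrev := R.card_revisits
      have hle := R.le
      have hl5 := R.len_le H hx
      have hprev := fun u hu hu' h₁ hp => R.prev_lt H (u := u) hu hu' h₁ hp
      have hbound : ∀ r : List ℕ, (∀ q ∈ L.positions, q < t - gap s t → q ∈ r) →
          K ≤ c + l + (r.length + excess G t) := by
        intro r hr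
        have := two_mul_card_revisits_le (s := s) (t + l) r fun u hu hu' h₁ hp =>
          hr _ (S.prev_mem u (by omega) hu' h₁ (by have := hprev u hu hu' h₁ hp; omega)).1
            (hprev u hu hu' h₁ hp)
        omega
      refine tryGaps_of_gap H h₀ ht' S.removable S.good
        (S.prev_mem t le_rfl ht' h₀ (by omega)).1
        (fun q _ y hy => absurd hy (by simp [bitAt_zero])) (by have := S.length; omega) ?_ ?_
      · intro r hr
        have := hbound r hr
        omega
      · intro Zp rest h' a g₁ g₂ g₃ g₄ g₅
        refine tryRun_of_isRun H hx hdet R ?_ ?_ 31 1 _ one_pos hl (by omega) ?_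
        · intro i hi
          have e := R.gap_eq i hi
          rcases Nat.lt_or_ge (t - gap s t + i) t with h₁ | h₁
          · right
            have := (S.prev_mem (t + i) (by omega) (by omega) (by omega) (by omega)).2
            rwa [e, show t + i - gap s t = t - gap s t + i by omega] at this
          · exact Or.inl h₁
        · have S' := S.close H R g₁ g₂ g₃ g₄ g₅
          have hcard : (revisits s (t + l)).card ≤ 32 - (t + l) :=
            (Finset.card_filter_le _ _).trans_eq (Nat.card_Ico _ _)
          have hp : prune K (c + l) (t + l) h' (excess G t) = false := by
            have := hbound _ g₅
            rw [prune_eq, Bool.or_eq_false_iff, decide_eq_false_iff_not, decide_eq_false_iff_not]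
            omega
          rw [close_eq, hp, if_neg (by simp)]
          exact ih S' (by omega)
        · intro i
          rw [bitAt_xor, bitAt_shiftRight, bitAt_shiftRight, Nat.add_sub_cancel,
            Nat.add_sub_cancel]

/-- A search without success bounds the number of revisits. -/
theorem IsRigid.card_revisits_lt (H : IsRigid s x 31) (hx : HasBits x) {det : Bool}
    (hdet : det = true → IsDeterministic s x 31) {K : ℕ}
    (hK : search det K 33 0 32 0 .nil 0 0 0 .nil = false) : 2 * (revisits s 0).card < K := by
  by_contra hc
  refine absurd (SearchState.search_eq_true H hx hdet (K := K) 33 (t := 0) (c := 32) (h := 0)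
    (L := .nil) (B := 0) (G := 0) (Z := 0) (rs := .nil) ?_ (by omega)) (by simp [hK])
  refine ⟨by omega, by omega, le_rfl, trivial, fun u _ _ _ hu => absurd hu (by omega), ?_, ?_,
    trivial⟩
  · exact fun u _ _ hu => absurd hu (by simp [bitAt_zero])
  · exact fun u hu => absurd hu (by simp [bitAt_zero])

/-- Each state has only one first visit. -/
theorem le_card_add_card_revisits [Fintype σ] (s : ℕ → σ) :
    32 ≤ Fintype.card σ + (revisits s 0).card := by
  classical
  set N := (Finset.Ico 0 32).filter fun u => ¬ 0 < gap s u with hN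
  have e : (revisits s 0).card + N.card = 32 := by
    rw [revisits, hN, Finset.card_filter_add_card_filter_not, Nat.card_Ico]
  have h : N.card ≤ Fintype.card σ := by
    rw [← Finset.card_univ]
    refine Finset.card_le_card_of_injOn s (fun _ _ => Finset.mem_coe.2 (Finset.mem_univ _)) ?_
    intro u hu v hv huv
    have hu' : ¬ 0 < gap s u := (Finset.mem_filter.1 hu).2
    have hv' : ¬ 0 < gap s v := (Finset.mem_filter.1 hv).2
    by_contra hne
    rcases Nat.lt_or_gt_of_ne hne with h | h
    · exact hv' (gap_le (d := v - u) (by omega) (by omega)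
        (by rw [Nat.sub_sub_self h.le, huv])).1
    · exact hu' (gap_le (d := u - v) (by omega) (by omega)
        (by rw [Nat.sub_sub_self h.le, huv])).1
  omega

end Soundness

section Automata

variable {σ α : Type}

/-! ### Rigid walks and automata -/

/-- A walk is rigid if, from each of its states, the only edges that still lead to the end in time
are those of the walk itself; `C k` may be any set of states that contains those from which the end
can be reached in `k` steps. -/
theorem isRigid_of_coreachable {s : ℕ → σ} {x : ℕ → α} {n : ℕ} (C : ℕ → σ → Prop)
    (h₀ : C 0 (s n)) (h₁ : ∀ k < n, ∀ j < n, C k (s (j + 1)) → C (k + 1) (s j))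
    (h₂ : ∀ r < n, ∀ j < n, s j = s r → C (n - (r + 1)) (s (j + 1)) →
      s (j + 1) = s (r + 1) ∧ x j = x r) : IsRigid s x n := by
  have hC : ∀ w u, Trace s x n w u (s n) → w.length ≤ n → C w.length u := by
    intro w
    induction w with
    | nil => rintro u rfl -; exact h₀
    | cons c w ih =>
      rintro u ⟨j, hj, rfl, -, h⟩ hl
      rw [List.length_cons] at hl
      exact h₁ _ hl _ hj (ih _ h (by omega))
  have key : ∀ w₁ r v w₂, Trace s x n w₁ (s r) v → Trace s x n w₂ v (s n) →
      r + w₁.length + w₂.length = n →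
      v = s (r + w₁.length) ∧ w₁ = (List.range w₁.length).map fun i => x (r + i) := by
    intro w₁
    induction w₁ with
    | nil => rintro r v w₂ rfl - -; simp
    | cons c w ih =>
      rintro r v w₂ ⟨j, hj, hr, rfl, h⟩ h' hl
      rw [List.length_cons] at hl
      have e := hC _ _ (h.append h') (by rw [List.length_append]; omega)
      rw [List.length_append, show w.length + w₂.length = n - (r + 1) by omega] at e
      obtain ⟨e₁, e₂⟩ := h₂ r (by omega) j hj hr.symm e
      rw [e₁] at h
      obtain ⟨e₃, e₄⟩ := ih (r + 1) v w₂ h h' (by omega)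
      refine ⟨by rw [e₃, List.length_cons]; congr 1; omega, ?_⟩
      rw [List.length_cons, List.range_succ_eq_map, List.map_cons, List.map_map, add_zero, e₂]
      congr 1
      conv_lhs => rw [e₄]
      refine List.map_congr_left fun i _ => ?_
      simp only [Function.comp_apply]
      congr 1; omega
  refine ⟨fun w₁ w₂ v hw₁ hw₂ hl => ?_, fun w hw hl => ?_⟩
  · simpa using (key w₁ 0 v w₂ hw₁ hw₂ (by omega)).1
  · have := (key w 0 (s n) [] hw rfl (by simp; omega)).2
    simpa [hl] using this

namespace PartialDFA

theorem exists_run {f : σ → α → Option σ} {w : List α} {u v : σ}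
    (h : w.foldlM f u = some v) : ∃ s : ℕ → σ, s 0 = u ∧ s w.length = v ∧
      ∀ (j : ℕ) (hj : j < w.length), f (s j) w[j] = some (s (j + 1)) := by
  induction w generalizing u with
  | nil => exact ⟨fun _ => u, rfl, by simpa using h, by simp⟩
  | cons c w ih =>
    rw [List.foldlM_cons] at h
    obtain ⟨z, hz, h⟩ := Option.bind_eq_some_iff.1 h
    obtain ⟨s, h₀, h₁, h₂⟩ := ih h
    refine ⟨fun j => j.casesOn u s, rfl, h₁, ?_⟩
    rintro (_ | j) hj
    · simpa [h₀] using hz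
    · exact h₂ j (by simpa using hj)

theorem foldlM_of_trace {f : σ → α → Option σ} {s : ℕ → σ} {x : ℕ → α} {n : ℕ}
    (hf : ∀ j < n, f (s j) (x j) = some (s (j + 1))) {w : List α} {u v : σ}
    (h : Trace s x n w u v) : w.foldlM f u = some v := by
  induction w generalizing u with
  | nil => cases h; rfl
  | cons c w ih =>
    obtain ⟨j, hj, rfl, rfl, h⟩ := h
    rw [List.foldlM_cons, hf j hj]
    exact ih h

/-- The run of a partial automaton on the only word of its length that it accepts is rigid. -/
theorem exists_isRigid (M : PartialDFA α σ) (x : ℕ → α) (n : ℕ)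
    (h : M.accepts ∩ {w | w.length = n} = {(List.range n).map x}) :
    ∃ s : ℕ → σ, IsRigid s x n ∧ IsDeterministic s x n := by
  have hmem : (List.range n).map x ∈ M.accepts ∩ {w | w.length = n} := h ▸ Set.mem_singleton _
  obtain ⟨⟨v, hv, he⟩, -⟩ := hmem
  obtain ⟨s, h₀, h₁, h₂⟩ := exists_run he
  have hs : ∀ j < n, M.step (s j) (x j) = some (s (j + 1)) := fun j hj => by
    have := h₂ j (by simpa using hj)
    rwa [List.getElem_map, List.getElem_range] at this
  rw [List.length_map, List.length_range] at h₁
  have hw : ∀ w, Trace s x n w (s 0) (s n) → w.length = n → w = (List.range n).map x := by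
    intro w ht hl
    have : w ∈ M.accepts ∩ {w | w.length = n} :=
      ⟨⟨v, hv, by rw [eval, ← h₀, foldlM_of_trace hs ht, h₁]⟩, hl⟩
    rwa [h] at this
  refine ⟨s, ⟨fun w₁ w₂ z ht₁ ht₂ hl => ?_, hw⟩, fun i hi j hj hij hx => ?_⟩
  · have e := hw _ (ht₁.append ht₂) (by simpa using hl)
    have e₁ : w₁ = (List.range w₁.length).map x := by
      have := congrArg (List.take w₁.length) e
      rwa [List.take_left, ← List.map_take, List.take_range, min_eq_left (by omega)] at this
    have ht := trace_segment (s := s) (x := x) (n := n) 0 w₁.length (by omega)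
    simp only [zero_add] at ht
    rw [← e₁] at ht
    exact Option.some_inj.1 ((foldlM_of_trace hs ht₁).symm.trans (foldlM_of_trace hs ht))
  · have := hs i hi
    rw [hij, hx, hs j hj] at this
    exact (Option.some_inj.1 this).symm

open Classical in
/-- The partial automaton whose transitions are the edges of a walk. -/
noncomputable def ofWalk (s : ℕ → σ) (x : ℕ → α) (n : ℕ) : PartialDFA α σ where
  step u c := if h : ∃ j < n, s j = u ∧ x j = c then some (s (h.choose + 1)) else none
  start := s 0
  accept := {s n}

theorem ofWalk_trace {s : ℕ → σ} {x : ℕ → α} {n : ℕ} {w : List α} {u v : σ}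
    (h : w.foldlM (ofWalk s x n).step u = some v) : Trace s x n w u v := by
  induction w generalizing u with
  | nil => exact Option.some_inj.1 h
  | cons c w ih =>
    rw [List.foldlM_cons] at h
    obtain ⟨z, hz, h⟩ := Option.bind_eq_some_iff.1 h
    simp only [ofWalk] at hz
    split_ifs at hz with hj
    obtain ⟨h₁, h₂, h₃⟩ := hj.choose_spec
    rw [Option.some_inj] at hz
    exact ⟨_, h₁, h₂.symm, h₃.symm, hz ▸ ih h⟩

end PartialDFA

theorem IsRigid.accepts_ofWalk {s : ℕ → σ} {x : ℕ → α} {n : ℕ} (H : IsRigid s x n)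
    (D : IsDeterministic s x n) :
    (PartialDFA.ofWalk s x n).accepts ∩ {w | w.length = n} = {(List.range n).map x} := by
  refine Set.Subset.antisymm ?_ ?_
  · rintro w ⟨⟨v, rfl, hv⟩, hl⟩
    exact H.word_eq w (PartialDFA.ofWalk_trace hv) hl
  · rintro w rfl
    refine ⟨⟨s n, rfl, ?_⟩, by simp⟩
    have ht := trace_segment (s := s) (x := x) (n := n) 0 n (by omega)
    simp only [zero_add] at ht
    refine PartialDFA.foldlM_of_trace (fun j hj => ?_) ht
    have hex : ∃ i < n, s i = s j ∧ x i = x j := ⟨j, hj, rfl, rfl⟩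
    obtain ⟨h₁, h₂, h₃⟩ := hex.choose_spec
    simp only [PartialDFA.ofWalk]
    rw [dif_pos hex, D _ h₁ j hj h₂ h₃]

namespace NFA

variable {M : NFA α σ}

/-- The state that a path visits at a given time; after its end, the path stays where it is. -/
def Path.stateAt {u v : σ} {w : List α} : M.Path u v w → ℕ → σ
  | .nil s, _ => s
  | .cons _ s _ _ _ _ _, 0 => s
  | .cons _ _ _ _ _ _ p, k + 1 => p.stateAt k

theorem Path.stateAt_zero {u v : σ} {w : List α} (p : M.Path u v w) : p.stateAt 0 = u := by
  cases p <;> rfl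

theorem Path.stateAt_length {u v : σ} {w : List α} (p : M.Path u v w) :
    p.stateAt w.length = v := by
  induction p with
  | nil s => rfl
  | cons t s u a x h p ih => exact ih

theorem Path.stateAt_succ_mem {u v : σ} {w : List α} (p : M.Path u v w) (j : ℕ)
    (hj : j < w.length) : p.stateAt (j + 1) ∈ M.step (p.stateAt j) w[j] := by
  induction p generalizing j with
  | nil s => simp at hj
  | cons t s u a x h p ih =>
    match j with
    | 0 => simpa [Path.stateAt, p.stateAt_zero] using h
    | j + 1 => exact ih j (by simpa using hj)

theorem Path.eq_of_stateAt {u v : σ} {w : List α} (p q : M.Path u v w)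
    (h : ∀ k ≤ w.length, p.stateAt k = q.stateAt k) : p = q := by
  induction p with
  | nil s => cases q; rfl
  | cons t s u a x ht p ih =>
    cases q with
    | cons t' _ _ _ _ ht' q =>
      obtain rfl : t = t' := by
        have := h 1 (by simp)
        simpa [Path.stateAt, Path.stateAt_zero] using this
      rw [ih q fun k hk => h (k + 1) (by simpa using hk)]

theorem Path.exists_append {u v z : σ} {w₁ w₂ : List α} (p : M.Path u v w₁)
    (q : M.Path v z w₂) : ∃ r : M.Path u z (w₁ ++ w₂), r.stateAt w₁.length = v := by
  induction p with
  | nil s => exact ⟨q, q.stateAt_zero⟩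
  | cons t s u a x h p ih =>
    obtain ⟨r, hr⟩ := ih q
    exact ⟨.cons t s z a _ h r, hr⟩

theorem nonempty_path_of_trace {s : ℕ → σ} {x : ℕ → α} {n : ℕ}
    (hM : ∀ j < n, s (j + 1) ∈ M.step (s j) (x j)) {w : List α} {u v : σ}
    (h : Trace s x n w u v) : Nonempty (M.Path u v w) := by
  induction w generalizing u with
  | nil => cases h; exact ⟨.nil _⟩
  | cons c w ih =>
    obtain ⟨j, hj, rfl, rfl, h⟩ := h
    obtain ⟨p⟩ := ih h
    exact ⟨.cons _ _ _ _ _ (hM j hj) p⟩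

/-- The only accepting path of a given length is rigid. -/
theorem exists_isRigid (M : NFA α σ) (x : ℕ → α) (n : ℕ) (hx : (List.range n).map x ∈ M.accepts)
    (hM : Subsingleton (M.AcceptingPath n)) : ∃ s : ℕ → σ, IsRigid s x n := by
  obtain ⟨u, hu, v, hv, ⟨p⟩⟩ := accepts_iff_exists_path.1 hx
  have hs : ∀ j < n, p.stateAt (j + 1) ∈ M.step (p.stateAt j) (x j) := fun j hj => by
    have := p.stateAt_succ_mem j (by simpa using hj)
    rwa [List.getElem_map, List.getElem_range] at this
  have h₁ : p.stateAt n = v := by simpa using p.stateAt_length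
  have key : ∀ w (q : M.Path u v w), w.length = n →
      w = (List.range n).map x ∧ ∀ k, q.stateAt k = p.stateAt k := by
    intro w q hl
    let P : M.AcceptingPath n := ⟨⟨u, hu⟩, ⟨v, hv⟩, ⟨(List.range n).map x, by simp⟩, p⟩
    let Q : M.AcceptingPath n := ⟨⟨u, hu⟩, ⟨v, hv⟩, ⟨w, hl⟩, q⟩
    have e : Q = P := Subsingleton.elim _ _
    exact ⟨congrArg (fun R : M.AcceptingPath n => R.2.2.1.1) e,
      fun k => congrArg (fun R : M.AcceptingPath n => Path.stateAt R.2.2.2 k) e⟩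
  refine ⟨p.stateAt, fun w₁ w₂ z ht₁ ht₂ hl => ?_, fun w ht hl => ?_⟩
  · rw [p.stateAt_zero] at ht₁
    rw [h₁] at ht₂
    obtain ⟨p₁⟩ := nonempty_path_of_trace hs ht₁
    obtain ⟨p₂⟩ := nonempty_path_of_trace hs ht₂
    obtain ⟨r, hr⟩ := p₁.exists_append p₂
    rw [← hr, (key _ r (by simpa using hl)).2]
  · rw [p.stateAt_zero, h₁] at ht
    obtain ⟨q⟩ := nonempty_path_of_trace hs ht
    exact (key w q hl).1

/-- The nondeterministic automaton whose transitions are the edges of a walk. -/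
def ofWalk (s : ℕ → σ) (x : ℕ → α) (n : ℕ) : NFA α σ where
  step u c := {v | ∃ j < n, u = s j ∧ c = x j ∧ v = s (j + 1)}
  start := {s 0}
  accept := {s n}

theorem Path.trace {s : ℕ → σ} {x : ℕ → α} {n : ℕ} {w : List α} {u v : σ}
    (p : (ofWalk s x n).Path u v w) {k : ℕ} (hk : k ≤ w.length) :
    Trace s x n (w.take k) u (p.stateAt k) ∧ Trace s x n (w.drop k) (p.stateAt k) v := by
  induction p generalizing k with
  | nil u => 
    rw [List.length_nil, Nat.le_zero] at hk
    subst hk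
    exact ⟨rfl, rfl⟩
  | cons t u v a w h p ih =>
    obtain ⟨j, hj, hu, ha, rfl⟩ := h
    match k with
    | 0 => exact ⟨rfl, j, hj, hu, ha, (p.stateAt_zero ▸ (ih (Nat.zero_le _)).2 :)⟩
    | k + 1 =>
      obtain ⟨h₁, h₂⟩ := ih (k := k) (by simpa using hk)
      exact ⟨⟨j, hj, hu, ha, h₁⟩, h₂⟩

end NFA

theorem NFA.ofWalk_step_mem (s : ℕ → σ) (x : ℕ → α) (n : ℕ) :
    ∀ j < n, s (j + 1) ∈ (NFA.ofWalk s x n).step (s j) (x j) :=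
  fun j hj => ⟨j, hj, rfl, rfl, rfl⟩

theorem NFA.mem_accepts_ofWalk (s : ℕ → σ) (x : ℕ → α) (n : ℕ) :
    (List.range n).map x ∈ (NFA.ofWalk s x n).accepts := by
  have ht := trace_segment (s := s) (x := x) (n := n) 0 n (by omega)
  simp only [zero_add] at ht
  exact NFA.accepts_iff_exists_path.2
    ⟨_, rfl, _, rfl, NFA.nonempty_path_of_trace (NFA.ofWalk_step_mem s x n) ht⟩

theorem IsRigid.subsingleton_acceptingPath {s : ℕ → σ} {x : ℕ → α} {n : ℕ} (H : IsRigid s x n) :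
    Subsingleton ((NFA.ofWalk s x n).AcceptingPath n) := by
  constructor
  rintro ⟨⟨_, rfl⟩, ⟨_, rfl⟩, ⟨w, hw⟩, p⟩ ⟨⟨_, rfl⟩, ⟨_, rfl⟩, ⟨w', hw'⟩, p'⟩
  have hword : ∀ w, (NFA.ofWalk s x n).Path (s 0) (s n) w → w.length = n →
      w = (List.range n).map x := fun w p hl =>
    H.word_eq w (p.stateAt_zero ▸ (p.trace (Nat.zero_le _)).2) hl
  have hstate : ∀ w (p : (NFA.ofWalk s x n).Path (s 0) (s n) w), w.length = n →
      ∀ k ≤ w.length, p.stateAt k = s k := fun w p hl k hk => by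
    obtain ⟨h₁, h₂⟩ := p.trace hk
    have := H.state_eq _ _ _ h₁ h₂ (by simp; omega)
    rwa [List.length_take, min_eq_left hk] at this
  obtain rfl : w = w' := (hword w p hw).trans (hword w' p' hw').symm
  rw [p.eq_of_stateAt p' fun k hk => (hstate w p hw k hk).trans (hstate w p' hw' k hk).symm]

end Automata

section Values

/-! ### The values of the complexities -/

/-- The periodic sequence with period `mSeq`. -/
def letter (t : ℕ) : ZMod 2 := mSeq.getD (t % 31) 0

theorem map_letter : (List.range 31).map letter = mSeq := by decide +kernel

theorem hasBits_letter : HasBits letter := by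
  unfold HasBits
  decide +kernel

theorem letter_congr {a b : ℕ} (h : a % 31 = b % 31) : letter a = letter b := by
  rw [letter, h, letter]

theorem le_detComplexity_mSeq {q : ℕ} (M : PartialDFA (ZMod 2) (Fin q))
    (h : M.accepts ∩ {w | w.length = mSeq.length} = {mSeq}) : 18 ≤ q := by
  obtain ⟨s, H, D⟩ := M.exists_isRigid letter 31 (map_letter ▸ h)
  have h₁ := H.card_revisits_lt hasBits_letter (fun _ => D) search_deterministic
  have h₂ := le_card_add_card_revisits s
  rw [Fintype.card_fin] at h₂
  omega

theorem le_nondetComplexity_mSeq {q : ℕ} (M : NFA (ZMod 2) (Fin q)) (h : mSeq ∈ M.accepts)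
    (hM : Subsingleton (M.AcceptingPath mSeq.length)) : 16 ≤ q := by
  obtain ⟨s, H⟩ := NFA.exists_isRigid M letter 31 (map_letter ▸ h) hM
  have h₁ := H.card_revisits_lt hasBits_letter (det := false) (by simp) search_nondeterministic
  have h₂ := le_card_add_card_revisits s
  rw [Fintype.card_fin] at h₂
  omega

/-- The bit mask of the states from which the walk `s` of length `31` can reach its end in `k`
steps along its own edges. -/
noncomputable def coreachable (s : ℕ → ℕ) (k : ℕ) : ℕ :=
  Nat.rec (Nat.shiftLeft 1 (s 31)) (fun _ B => force B fun B =>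
    (List.range 31).foldl (fun A j => if bitAt B (s (j + 1)) then Nat.lor A (Nat.shiftLeft 1 (s j))
      else A) 0) k

/-- The walk from `0` up to `15`, around a loop there, and back down to `0`. -/
def palindromicWalk (t : ℕ) : Fin 16 := Fin.ofNat 16 (min t (31 - t))

theorem isRigid_palindromicWalk : IsRigid palindromicWalk letter 31 := by
  refine isRigid_of_coreachable (fun k u => bitAt (coreachable (fun t => palindromicWalk t) k) u)
    ?_ ?_ ?_ <;> decide +kernel

/-- A walk that visits only `18` states: relative to the first visits of states, it goes back by
`2`, `3`, `9`, `17` and `23` steps at the times `2`, `17`, `19`, `24` and `27`. -/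
def deterministicWalk (t : ℕ) : Fin 18 :=
  [0, 1, 0, 1, 2, 3, 4, 5, 6, 7, 8, 9, 10, 11, 12, 13, 14, 12, 13, 8, 9, 10, 11, 15, 5, 6, 7, 2, 3,
    4, 16, 17].getD t 0

theorem isRigid_deterministicWalk : IsRigid deterministicWalk letter 31 := by
  refine isRigid_of_coreachable (fun k u => bitAt (coreachable (fun t => deterministicWalk t) k) u)
    ?_ ?_ ?_ <;> decide +kernel

theorem isDeterministic_deterministicWalk : IsDeterministic deterministicWalk letter 31 := by
  unfold IsDeterministic
  decide +kernel

theorem detComplexity_mSeq : detComplexity mSeq = 18 := by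
  have h := isRigid_deterministicWalk.accepts_ofWalk isDeterministic_deterministicWalk
  rw [map_letter] at h
  exact le_antisymm (Nat.sInf_le ⟨_, h⟩)
    (le_csInf ⟨_, _, h⟩ fun _ ⟨M, hM⟩ => le_detComplexity_mSeq M hM)

theorem nondetComplexity_mSeq : nondetComplexity mSeq = 16 := by
  have h₁ := NFA.mem_accepts_ofWalk palindromicWalk letter 31
  have h₂ := isRigid_palindromicWalk.subsingleton_acceptingPath
  rw [map_letter] at h₁
  exact le_antisymm (Nat.sInf_le ⟨_, h₁, h₂⟩)
    (le_csInf ⟨_, _, h₁, h₂⟩ fun _ ⟨M, hM, hM'⟩ => le_nondetComplexity_mSeq M hM hM')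

/-! ### The shift register -/

/-- The feedback function `x (t + 5) = x t + x (t + 2) + x (t + 3) + x (t + 4)`. -/
def feedback : (Fin 5 → ZMod 2) →ₗ[ZMod 2] ZMod 2 :=
  (LinearMap.proj 0 : (Fin 5 → ZMod 2) →ₗ[ZMod 2] ZMod 2) + LinearMap.proj 2 + LinearMap.proj 3 +
    LinearMap.proj 4

theorem feedback_letter (t : ℕ) : feedback (fun i => letter (t + i)) = letter (t + 5) := by
  have key : ∀ r < 31, letter (r + 0) + letter (r + 2) + letter (r + 3) + letter (r + 4) =
      letter (r + 5) := by decide +kernel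
  have h := key (t % 31) (Nat.mod_lt _ (by norm_num))
  have e (i : ℕ) : letter (t % 31 + i) = letter (t + i) := letter_congr (by omega)
  rw [e, e, e, e, e] at h
  exact h

theorem iterate_shiftRegister (t : ℕ) :
    (shiftRegister feedback)^[t] (fun i : Fin 5 => letter i) = fun i : Fin 5 => letter (t + i) := by
  induction t with
  | zero => simp
  | succ t ih =>
    rw [Function.iterate_succ_apply', ih]
    funext i
    unfold shiftRegister
    split_ifs with hi
    · exact congrArg letter (by simp only; omega)
    · rw [feedback_letter]
      exact congrArg letter (by omega)

theorem eventualPeriod_shiftRegister :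
    eventualPeriod (fun t => (shiftRegister feedback)^[t] (fun i : Fin 5 => letter i)) = 31 := by
  simp only [iterate_shiftRegister]
  have hmem : 31 ∈ {N | 0 < N ∧ ∃ M, ∀ n, M ≤ n →
      (fun i : Fin 5 => letter (n + N + i)) = fun i : Fin 5 => letter (n + i)} :=
    ⟨by norm_num, 0, fun n _ => funext fun i => letter_congr (by omega)⟩
  refine le_antisymm (Nat.sInf_le hmem) (le_csInf ⟨_, hmem⟩ ?_)
  rintro N ⟨hN, M, h⟩
  by_contra hlt
  have key : ∀ N < 31, 0 < N → ¬ ∀ i : Fin 5, letter (N + i) = letter i := by decide +kernel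
  refine key N (by omega) hN fun i => ?_
  have e : letter (31 * M + N + i) = letter (31 * M + i) := congrFun (h (31 * M) (by omega)) i
  rw [letter_congr (a := 31 * M + N + i) (b := N + i) (by omega),
    letter_congr (a := 31 * M + i) (b := i) (by omega)] at e
  exact e

theorem isMSequence_mSeq : IsMSequence mSeq :=
  ⟨5, feedback, letter, by norm_num, iterate_shiftRegister, eventualPeriod_shiftRegister, by decide +kernel⟩

end Values

theorem theorem5 :
    (∃ x : List (ZMod 2), 2 ≤ (detComplexity x : ℤ) - (nondetComplexity x : ℤ)) ∧
    (∃ x : List (ZMod 2), IsMSequence x ∧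
      (detComplexity x : ℤ) - (nondetComplexity x : ℤ) = 2) ∧
    IsMSequence mSeq ∧ detComplexity mSeq = 18 ∧ nondetComplexity mSeq = 16 := by
  have h : (detComplexity mSeq : ℤ) - (nondetComplexity mSeq : ℤ) = 2 := by
    rw [detComplexity_mSeq, nondetComplexity_mSeq]; norm_num
  exact ⟨⟨mSeq, h.ge⟩, ⟨mSeq, isMSequence_mSeq, h⟩, isMSequence_mSeq, detComplexity_mSeq,
    nondetComplexity_mSeq⟩
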